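/- Let $h_n(x)=(2^n n!)^{-1/2}\pi^{-1/4}H_n(x)e^{-x^2/2}$, $n\ge 0$, be the Hermite functions (Fock states), where $H_n$ is the (physicists') Hermite polynomial of degree $n$, let $N\ge 0$, and let $\mathcal H$ be a linear subspace of $\mathcal H^N=\mathrm{span}\{h_0,\dots,h_N\}\subset L^2(\mathbb R)$. Let $\mathcal A(\mathcal H)$ be the real affine space of self-adjoint operators on $\mathcal H$ with trace $1$, with the topology of the trace norm $\|A\|_1=\mathrm{tr}\sqrt{A^\dagger A}$, and let $\mathcal D(\mathcal H)=\{\rho\in\mathcal A(\mathcal H):\rho\ge 0\}$ be the set of density matrices. An operator $\rho$ on $\mathcal H$ has the Wigner function $$W\rho(x,\xi)=\frac1{2\pi}\int_{\mathbb R}e^{-i\xi y}K_\rho\left(x+\tfrac y2,x-\tfrac y2\right)dy,$$ where $K_\rho$ is the integral kernel of $\rho$ (extended by $0$ to $\mathcal H^\perp$). Let $\mathcal N(\rho)=\{z\in\mathbb R^2: W\rho(z)=0\}$ be its nodal set. Put $\mathcal D_+(\mathcal H)=\{\rho\in\mathcal D(\mathcal H): W\rho\ge 0 \text{ on }\mathbb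 R^2\}$ and $\mathcal D_{0+}(\mathcal H)=\{\rho\in\mathcal D_+(\mathcal H):\mathcal N(\rho)\ne\emptyset\}$. Write $\mathrm{int}_{\mathcal A(\mathcal H)}$ and $\partial_{\mathcal A(\mathcal H)}$ for interior and boundary in the relative topology of $\mathcal A(\mathcal H)$, and $\mathrm{iint}\,\mathcal D(\mathcal H)$ and $\partial^i\mathcal D(\mathcal H)$ for the interior and boundary of $\mathcal D(\mathcal H)$ relative to its affine hull. Then: 1. For every $\rho\in\mathcal D(\mathcal H)$: $\rho\in\mathrm{int}_{\mathcal A(\mathcal H)}\mathcal D_+(\mathcal H)$ if and only if $\rho$ has maximal rank (that is, $\mathrm{rank}\,\rho=\dim\mathcal H$) and $\mathcal N(\rho)=\emptyset$. 2. $\partial_{\mathcal A(\mathcal H)}\mathcal D_+(\mathcal H)=\mathcal D_{0+}(\mathcal H)\cup\left(\mathcal D_+(\mathcal H)\cap\partial^i\mathcal D(\mathcal H)\right)$. More precisely: (A) if $\rho\in\partial_{\mathcal A(\mathcal H)}\mathcal D_+(\mathcal H)\cap\mathrm{iint}\,\mathcal D(\mathcal H)$, then $\rho\in\mathcal D_{0+}(\mathcal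 H)$; (B) $\rho\in\partial_{\mathcal A(\mathcal H)}\mathcal D_+(\mathcal H)\cap\partial^i\mathcal D(\mathcal H)$ if and only if $\rho\in\mathcal D_+(\mathcal H)\cap\partial^i\mathcal D(\mathcal H)$. -/

import Mathlib

open MeasureTheory

namespace WignerPositive

/-! ### Hermite functions and the spaces `ℋ^N` -/

/-- The Hilbert space `L²(ℝ)` of complex-valued functions. -/
abbrev L2R : Type := Lp ℂ 2 (volume : Measure ℝ)

/-- The (physicists') Hermite polynomials: `H₀ = 1`, `Hₙ₊₁ = 2 x Hₙ - Hₙ'`. -/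
noncomputable def hermitePoly : ℕ → Polynomial ℝ
  | 0 => 1
  | n + 1 => 2 * Polynomial.X * hermitePoly n - Polynomial.derivative (hermitePoly n)

/-- The Hermite function `hₙ(x) = (2ⁿ n!)^(-1/2) π^(-1/4) Hₙ(x) exp(-x²/2)`. -/
noncomputable def hermiteFun (n : ℕ) (x : ℝ) : ℂ :=
  (((2 ^ n * (n.factorial : ℝ)) ^ (-(1 / 2) : ℝ) * Real.pi ^ (-(1 / 4) : ℝ)
    * (hermitePoly n).eval x * Real.exp (-(1 / 2) * x ^ 2) : ℝ) : ℂ)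

theorem integrable_poly_mul_exp_neg_sq (p : Polynomial ℝ) :
    Integrable (fun x : ℝ => p.eval x * Real.exp (-1 * x ^ 2)) := by
  induction p using Polynomial.induction_on' with
  | add p q hp hq =>
    refine (hp.add hq).congr ?_
    filter_upwards with x
    simp only [Polynomial.eval_add, add_mul, Pi.add_apply]
  | monomial n a =>
    have h := (integrable_rpow_mul_exp_neg_mul_sq (b := 1) one_pos (s := (n : ℝ))
      (by linarith [(Nat.cast_nonneg n : (0 : ℝ) ≤ n)])).const_mul a
    simpa only [Polynomial.eval_monomial, Real.rpow_natCast, mul_assoc] using h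

theorem memLp_hermiteFun (n : ℕ) : MemLp (hermiteFun n) 2 (volume : Measure ℝ) := by
  have hc : Continuous (hermiteFun n) := by
    unfold hermiteFun
    fun_prop
  rw [memLp_two_iff_integrable_sq_norm hc.aestronglyMeasurable]
  refine ((integrable_poly_mul_exp_neg_sq (hermitePoly n ^ 2)).const_mul
    (((2 ^ n * (n.factorial : ℝ)) ^ (-(1 / 2) : ℝ) * Real.pi ^ (-(1 / 4) : ℝ)) ^ 2)).congr ?_
  filter_upwards with x
  have he : Real.exp (-1 * x ^ 2) = Real.exp (-(1 / 2) * x ^ 2) ^ 2 := by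
    rw [← Real.exp_nat_mul]
    congr 1
    push_cast
    ring
  rw [hermiteFun, Complex.norm_real, Real.norm_eq_abs, sq_abs, he, Polynomial.eval_pow]
  ring

/-- The Fock state `|n⟩`, i.e. the Hermite function `hₙ` as an element of `L²(ℝ)`. -/
noncomputable def fock (n : ℕ) : L2R := (memLp_hermiteFun n).toLp (hermiteFun n)

/-- `ℋ^N`, the span of the Fock states `|0⟩, …, |N⟩`. -/
noncomputable def fockSpan (N : ℕ) : Submodule ℂ L2R :=
  Submodule.span ℂ (fock '' Set.Iic N)

/-- Every subspace of `ℋ^N` is finite-dimensional. -/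
theorem finiteDimensional_of_le_fockSpan {N : ℕ} {H : Submodule ℂ L2R} (hH : H ≤ fockSpan N) :
    FiniteDimensional ℂ H := by
  have : FiniteDimensional ℂ (fockSpan N) :=
    FiniteDimensional.span_of_finite ℂ ((Set.finite_Iic N).image fock)
  exact Submodule.finiteDimensional_of_le hH

/-! ### Operators on a finite-dimensional Hilbert space and the trace norm -/

section Operators

variable {E : Type*} [NormedAddCommGroup E] [InnerProductSpace ℂ E] [FiniteDimensional ℂ E]

/-- The trace norm `‖T‖₁ = tr |T|`, i.e. the sum of the singular values of `T`
(the eigenvalues of `|T| = √(T† T)`, with multiplicity); cf. `trace_eq_traceNorm`. -/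
noncomputable def traceNorm (T : E →ₗ[ℂ] E) : ℝ :=
  ∑ i ∈ Finset.range (Module.finrank ℂ E), T.singularValues i

/-- If `P` is the positive square root of `T† T`, then `tr P` is the trace norm of `T`. -/
theorem trace_eq_traceNorm (T P : E →ₗ[ℂ] E) (hP : P.IsPositive)
    (hPT : P ∘ₗ P = LinearMap.adjoint T ∘ₗ T) :
    LinearMap.trace ℂ E P = (traceNorm T : ℂ) := by
  set S := T.isSymmetric_adjoint_comp_self
  have hS0 : ∀ i, 0 ≤ S.eigenvalues rfl i := fun i =>
    T.isPositive_adjoint_comp_self.nonneg_eigenvalues rfl i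
  have key : ∀ i, P (S.eigenvectorBasis rfl i)
      = ((√(S.eigenvalues rfl i) : ℝ) : ℂ) • S.eigenvectorBasis rfl i := by
    intro i
    set u := S.eigenvectorBasis rfl i
    set s : ℝ := √(S.eigenvalues rfl i) with hs
    have hs0 : 0 ≤ s := Real.sqrt_nonneg _
    have hPP : P (P u) = ((s * s : ℝ) : ℂ) • u := by
      have h1 := S.apply_eigenvectorBasis rfl i
      have h2 : P (P u) = (LinearMap.adjoint T ∘ₗ T) u := LinearMap.congr_fun hPT u
      rw [hs, Real.mul_self_sqrt (hS0 i), h2]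
      exact h1
    rcases hs0.eq_or_lt with h0 | h0
    · have h2 : inner ℂ (P u) (P u) = 0 := by
        rw [hP.isSymmetric u (P u), hPP, ← h0]
        simp
      rw [inner_self_eq_zero.mp h2, ← h0]
      simp
    · have hv : P (P u - (s : ℂ) • u) = -((s : ℂ) • (P u - (s : ℂ) • u)) := by
        rw [map_sub, map_smul, hPP, smul_sub, smul_smul]
        push_cast
        abel
      have h3 := hP.re_inner_nonneg_left (P u - (s : ℂ) • u)
      rw [hv, inner_neg_left, inner_smul_left, Complex.conj_ofReal] at h3
      have h4 : ‖P u - (s : ℂ) • u‖ ^ 2 ≤ 0 := by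
        rw [inner_self_eq_norm_sq_to_K] at h3
        have h5 : RCLike.re (-((s : ℂ) * ((‖P u - (s : ℂ) • u‖ : ℝ) : ℂ) ^ 2))
            = -(s * ‖P u - (s : ℂ) • u‖ ^ 2) := by
          norm_cast
        have h6 : 0 ≤ -(s * ‖P u - (s : ℂ) • u‖ ^ 2) := by
          rw [← h5]
          exact h3
        nlinarith [sq_nonneg ‖P u - (s : ℂ) • u‖]
      have h7 : ‖P u - (s : ℂ) • u‖ = 0 := by
        nlinarith [sq_nonneg ‖P u - (s : ℂ) • u‖]
      exact sub_eq_zero.mp (norm_eq_zero.mp h7)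
  rw [LinearMap.trace_eq_sum_inner P (S.eigenvectorBasis rfl), traceNorm, Finset.sum_range]
  push_cast
  refine Finset.sum_congr rfl fun i _ => ?_
  rw [key, inner_smul_right, inner_self_eq_norm_sq_to_K, OrthonormalBasis.norm_eq_one,
    T.singularValues_fin rfl]
  simp

/-- The topology induced by the trace norm on the space of all operators on `E` (all of which are
trace-class, as `E` is finite-dimensional). -/
instance traceNormTopology : TopologicalSpace (E →ₗ[ℂ] E) where
  IsOpen U := ∀ T ∈ U, ∃ ε > 0, ∀ S : E →ₗ[ℂ] E, traceNorm (S - T) < ε → S ∈ U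
  isOpen_univ := fun _ _ => ⟨1, one_pos, fun _ _ => trivial⟩
  isOpen_inter := by
    rintro U V hU hV T ⟨hTU, hTV⟩
    obtain ⟨ε, hε, h⟩ := hU T hTU
    obtain ⟨δ, hδ, h'⟩ := hV T hTV
    exact ⟨min ε δ, lt_min hε hδ, fun S hS =>
      ⟨h S (hS.trans_le (min_le_left _ _)), h' S (hS.trans_le (min_le_right _ _))⟩⟩
  isOpen_sUnion := by
    rintro s hs T ⟨U, hU, hT⟩
    obtain ⟨ε, hε, h⟩ := hs U hU T hT
    exact ⟨ε, hε, fun S hS => ⟨U, hU, h S hS⟩⟩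

variable (E) in
/-- `𝒜(E)`: self-adjoint (trace-class) operators of unit trace. -/
def unitTraceSelfAdjoint : Set (E →ₗ[ℂ] E) :=
  {ρ | ρ.IsSymmetric ∧ LinearMap.trace ℂ E ρ = 1}

variable (E) in
/-- `𝒟(E)`: density matrices, i.e. positive self-adjoint operators of unit trace. -/
def densityMatrices : Set (E →ₗ[ℂ] E) :=
  {ρ | ρ ∈ unitTraceSelfAdjoint E ∧ ρ.IsPositive}

variable (E) in
/-- `iint 𝒟(E)`: the interior of `𝒟(E)` relative to its (real) affine hull. -/
def densityInterior : Set (E →ₗ[ℂ] E) := intrinsicInterior ℝ (densityMatrices E)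

variable (E) in
/-- `∂ⁱ𝒟(E)`: the boundary of `𝒟(E)` relative to its (real) affine hull. -/
def densityBoundary : Set (E →ₗ[ℂ] E) := intrinsicFrontier ℝ (densityMatrices E)

/-- `ρ` has maximal rank, i.e. its rank equals the dimension of the space. -/
def HasMaximalRank (ρ : E →ₗ[ℂ] E) : Prop :=
  Module.finrank ℂ (LinearMap.range ρ) = Module.finrank ℂ E

end Operators

/-! ### Wigner functions -/

section Wigner

variable {H : Submodule ℂ L2R} [FiniteDimensional ℂ H]

/-- The integral kernel `K_ρ(x, y) = ∑ᵢ (ρ eᵢ)(x) conj (eᵢ(y))` of an operator `ρ` on `H ⊆ L²(ℝ)`,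
where `(eᵢ)` is an orthonormal basis of `H`; cf. `integral_kernel`. -/
noncomputable def kernel (ρ : H →ₗ[ℂ] H) (x y : ℝ) : ℂ :=
  ∑ i, (ρ (stdOrthonormalBasis ℂ H i) : L2R) x
    * (starRingEnd ℂ) ((stdOrthonormalBasis ℂ H i : L2R) y)

/-- `kernel ρ` is the kernel of `ρ`, extended by zero to the orthogonal complement of `H`:
`∫ K_ρ(x, y) ψ(y) dy = (ρ P_H ψ)(x)` for every `ψ ∈ L²(ℝ)`. -/
theorem integral_kernel (ρ : H →ₗ[ℂ] H) (ψ : L2R) :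
    (fun x => ∫ y, kernel ρ x y * ψ y)
      =ᵐ[volume] ((ρ (H.orthogonalProjectionOnto ψ) : H) : L2R) := by
  set b := stdOrthonormalBasis ℂ H with hb
  have hint : ∀ i, Integrable (fun y => (starRingEnd ℂ) ((b i : L2R) y) * ψ y) := fun i => by
    have := L2.integrable_inner (𝕜 := ℂ) (b i : L2R) ψ
    simpa only [RCLike.inner_apply, mul_comm] using this
  have hinner : ∀ i, ∫ y, (starRingEnd ℂ) ((b i : L2R) y) * ψ y = inner ℂ (b i : L2R) ψ :=
    fun i => by
      rw [L2.inner_def]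
      simp only [RCLike.inner_apply, mul_comm]
  have hL : (fun x => ∫ y, kernel ρ x y * ψ y)
      = fun x => ∑ i, inner ℂ (b i : L2R) ψ * (ρ (b i) : L2R) x := by
    funext x
    simp only [kernel, Finset.sum_mul, mul_assoc]
    rw [integral_finsetSum _ fun i _ => (hint i).const_mul _]
    refine Finset.sum_congr rfl fun i _ => ?_
    rw [integral_const_mul, hinner, mul_comm]
  have hR : ((ρ (H.orthogonalProjectionOnto ψ) : H) : L2R)
      = ∑ i, inner ℂ (b i : L2R) ψ • (ρ (b i) : L2R) := by
    rw [b.orthogonalProjectionOnto_apply_eq_sum]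
    simp
  rw [hL, hR]
  have h1 : ∀ᵐ x, ∀ i, (inner ℂ (b i : L2R) ψ • (ρ (b i) : L2R) : L2R) x
      = inner ℂ (b i : L2R) ψ * (ρ (b i) : L2R) x := by
    rw [ae_all_iff]
    intro i
    filter_upwards [Lp.coeFn_smul (inner ℂ (b i : L2R) ψ) (ρ (b i) : L2R)] with x hx
    rw [hx]
    rfl
  filter_upwards [h1, Lp.coeFn_fun_finsetSum Finset.univ
    fun i => inner ℂ (b i : L2R) ψ • (ρ (b i) : L2R)] with x hx hx'
  rw [hx']
  exact Finset.sum_congr rfl fun i _ => (hx i).symm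

/-- The Wigner function
`Wρ(x, ξ) = (2π)⁻¹ ∫ exp(-iξy) K_ρ(x + y/2, x - y/2) dy`. -/
noncomputable def wigner (ρ : H →ₗ[ℂ] H) (z : ℝ × ℝ) : ℂ :=
  1 / (2 * Real.pi) *
    ∫ y : ℝ, Complex.exp (-Complex.I * z.2 * y) * kernel ρ (z.1 + y / 2) (z.1 - y / 2)

/-- The nodal set `𝒩(ρ)`: the zeros of the Wigner function. -/
def nodalSet (ρ : H →ₗ[ℂ] H) : Set (ℝ × ℝ) := {z | wigner ρ z = 0}

open scoped ComplexOrder in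
variable (H) in
/-- `𝒟₊(H)`: the Wigner-positive states. (`0 ≤ w` for a complex number `w` means that `w` is real
and nonnegative; the Wigner function of a self-adjoint operator is real.) -/
def wignerPositive : Set (H →ₗ[ℂ] H) :=
  {ρ | ρ ∈ densityMatrices H ∧ ∀ z, 0 ≤ wigner ρ z}

variable (H) in
/-- `𝒟₀₊(H)`: the Wigner-positive states with nonempty nodal set. -/
def wignerPositiveZero : Set (H →ₗ[ℂ] H) :=
  {ρ | ρ ∈ wignerPositive H ∧ (nodalSet ρ).Nonempty}

end Wigner

/-! ### Relative interior and boundary -/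

section Relative

variable {V : Type*} [TopologicalSpace V]

/-- The relative interior of `S` with respect to `X`: the interior of `S` in the topology induced
on `X`. -/
def relInterior (X S : Set V) : Set V :=
  (↑) '' interior ((↑) ⁻¹' S : Set X)

/-- The relative boundary of `S` with respect to `X`: the boundary of `S` in the topology induced
on `X`. -/
def relBoundary (X S : Set V) : Set V :=
  (↑) '' frontier ((↑) ⁻¹' S : Set X)

end Relative

end WignerPositive

open WignerPositive

/-!
The Wigner function of an operator `ρ` on `H` is a polynomial times `exp(-x² - ξ²)`. Shifting the
contour in its Fourier integral expresses it through `ζ = x - iξ`: the cross-Wigner function of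
`p exp(-x²/2)` and `q exp(-x²/2)` is, up to a constant,
`exp(-|ζ|²) ∫ p(ζ + u/2) conj (q(ζ - u/2)) exp(-u²/4) du` (`crossWigner_eq`). If `m` is the largest
degree that occurs in `H`, the polynomial factor grows at most like `|ζ|^(2m)`, uniformly on bounded
sets of operators (`exists_norm_operatorSymbol_le`), and its coefficient of `|ζ|^(2m)` is a positive
multiple of `⟨w, ρ w⟩` for a fixed nonzero vector `w` of `H` (`tendsto_operatorSymbol`).

The trace norm and the operator norm define the same topology, the affine hull of the density
matrices is the whole space of self-adjoint operators of trace one, and a density matrix is interior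
precisely when it has maximal rank (`relInterior_densityMatrices`).

A state `ρ` of maximal rank with empty nodal set is an interior point of the Wigner-positive states:
`⟨w, ρ w⟩ > 0`, so the polynomial factor of its Wigner function is bounded below by a multiple of
`(1 + |ζ|)^(2m)`, and this survives small perturbations (`mem_relInterior_wignerPositive`).

Conversely, let `ρ` be an interior point, with `Wρ(z) = 0`. The affine functional `σ ↦ Wσ(z)` has an
interior minimum at `ρ`, hence vanishes identically, and by polarization so do all cross-Wigner
functions of vectors of `H` at `z`. In terms of the parity `Π` about `z` this means that
`⟨φ, Π ψ⟩ = 0` for all `φ` and `ψ` in `H`. The overlap of `Wρ` with its reflection in `z` is a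
multiple of `tr (ρ Π ρ Π)`, so it is zero (`integral_wigner_mul_reflection`). As `Wρ ≥ 0`, the
product of `Wρ` with its reflection vanishes almost everywhere; but `Wρ` is positive near infinity
(`nodalSet_eq_empty_of_mem_relInterior`). No classification of the pure Wigner-positive states is
needed.

The set of Wigner-positive states being relatively closed, the description of its boundary follows.
-/

namespace WignerPositive

open Filter Topology
open scoped ComplexConjugate Polynomial FourierTransform

/-! ### The trace-norm topology -/

section TraceNorm

variable {E : Type*} [NormedAddCommGroup E] [InnerProductSpace ℂ E] [FiniteDimensional ℂ E]

/-- The operator norm of a linear map of a finite-dimensional space. -/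
noncomputable def opNorm (T : E →ₗ[ℂ] E) : ℝ := ‖LinearMap.toContinuousLinearMap T‖

theorem norm_apply_le_opNorm (T : E →ₗ[ℂ] E) (v : E) : ‖T v‖ ≤ opNorm T * ‖v‖ :=
  (LinearMap.toContinuousLinearMap T).le_opNorm v

theorem opNorm_nonneg (T : E →ₗ[ℂ] E) : 0 ≤ opNorm T := norm_nonneg _

theorem opNorm_smul (c : ℝ) (T : E →ₗ[ℂ] E) : opNorm (c • T) = |c| * opNorm T := by
  have : LinearMap.toContinuousLinearMap (c • T) = c • LinearMap.toContinuousLinearMap T := by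
    ext v; rfl
  rw [opNorm, this, norm_smul, Real.norm_eq_abs, opNorm]

/-- The singular values are the lengths of the images of the right singular vectors. -/
theorem singularValues_eq_norm_apply (T : E →ₗ[ℂ] E) (i : Fin (Module.finrank ℂ E)) :
    T.singularValues i
      = ‖T (T.isSymmetric_adjoint_comp_self.eigenvectorBasis rfl i)‖ := by
  set S := T.isSymmetric_adjoint_comp_self
  set u := S.eigenvectorBasis rfl i with hu
  have h1 : inner ℂ (T u) (T u) = ((S.eigenvalues rfl i : ℝ) : ℂ) := by
    rw [← LinearMap.adjoint_inner_right]
    have h2 : LinearMap.adjoint T (T u) = ((S.eigenvalues rfl i : ℝ) : ℂ) • u :=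
      S.apply_eigenvectorBasis rfl i
    rw [h2, inner_smul_right, inner_self_eq_norm_sq_to_K, hu, OrthonormalBasis.norm_eq_one]
    simp
  rw [T.singularValues_fin rfl, norm_eq_sqrt_re_inner (𝕜 := ℂ), h1]
  simp

theorem opNorm_le_traceNorm (T : E →ₗ[ℂ] E) : opNorm T ≤ traceNorm T := by
  have h0 : 0 ≤ traceNorm T := Finset.sum_nonneg fun i _ => T.singularValues_nonneg i
  refine ContinuousLinearMap.opNorm_le_bound _ h0 fun v => ?_
  set b := T.isSymmetric_adjoint_comp_self.eigenvectorBasis rfl with hb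
  have hv : T v = ∑ i, inner ℂ (b i) v • T (b i) := by
    conv_lhs => rw [← b.sum_repr' v]
    simp
  change ‖T v‖ ≤ _
  rw [hv, traceNorm, Finset.sum_range, Finset.sum_mul]
  refine (norm_sum_le _ _).trans (Finset.sum_le_sum fun i _ => ?_)
  rw [norm_smul, singularValues_eq_norm_apply, mul_comm]
  gcongr
  calc ‖inner ℂ (b i) v‖ ≤ ‖b i‖ * ‖v‖ := norm_inner_le_norm _ _
    _ = ‖v‖ := by rw [b.norm_eq_one, one_mul]

theorem traceNorm_le_finrank_mul_opNorm (T : E →ₗ[ℂ] E) :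
    traceNorm T ≤ Module.finrank ℂ E * opNorm T := by
  rw [traceNorm, Finset.sum_range]
  calc ∑ i : Fin (Module.finrank ℂ E), T.singularValues i
      ≤ ∑ _i : Fin (Module.finrank ℂ E), opNorm T := by
        refine Finset.sum_le_sum fun i _ => ?_
        rw [singularValues_eq_norm_apply]
        refine (norm_apply_le_opNorm T _).trans ?_
        rw [OrthonormalBasis.norm_eq_one, mul_one]
    _ = _ := by simp

/-- In finite dimension the trace norm and the operator norm define the same topology. -/
theorem isInducing_toContinuousLinearMap :
    IsInducing (LinearMap.toContinuousLinearMap : (E →ₗ[ℂ] E) ≃ₗ[ℂ] (E →L[ℂ] E)) := by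
  refine ⟨TopologicalSpace.ext_iff.mpr fun U => ?_⟩
  rw [isOpen_induced_iff]
  constructor
  · intro hU
    refine ⟨LinearMap.toContinuousLinearMap.symm ⁻¹' U, ?_, by ext; simp⟩
    rw [Metric.isOpen_iff]
    intro T hT
    obtain ⟨ε, hε, h⟩ := hU _ hT
    refine ⟨ε / (Module.finrank ℂ E + 1), by positivity, fun S hS => h _ ?_⟩
    rw [Metric.mem_ball, dist_eq_norm, lt_div_iff₀ (by positivity)] at hS
    have h1 : opNorm (LinearMap.toContinuousLinearMap.symm S
        - LinearMap.toContinuousLinearMap.symm T) = ‖S - T‖ := by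
      rw [← map_sub, opNorm, LinearEquiv.apply_symm_apply]
    have h2 := traceNorm_le_finrank_mul_opNorm (LinearMap.toContinuousLinearMap.symm S
        - LinearMap.toContinuousLinearMap.symm T)
    rw [h1] at h2
    nlinarith [norm_nonneg (S - T)]
  · rintro ⟨V, hV, rfl⟩ T hT
    obtain ⟨ε, hε, h⟩ := Metric.isOpen_iff.mp hV _ hT
    refine ⟨ε, hε, fun S hS => h ?_⟩
    rw [Metric.mem_ball, dist_eq_norm, ← map_sub]
    exact (opNorm_le_traceNorm _).trans_lt hS

theorem mem_nhds_iff_opNorm {U : Set (E →ₗ[ℂ] E)} {T : E →ₗ[ℂ] E} :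
    U ∈ 𝓝 T ↔ ∃ ε > 0, ∀ S, opNorm (S - T) < ε → S ∈ U := by
  rw [isInducing_toContinuousLinearMap.nhds_eq_comap, mem_comap]
  constructor
  · rintro ⟨V, hV, hVU⟩
    obtain ⟨ε, hε, h⟩ := Metric.mem_nhds_iff.mp hV
    refine ⟨ε, hε, fun S hS => hVU (h ?_)⟩
    rwa [Metric.mem_ball, dist_eq_norm, ← map_sub]
  · rintro ⟨ε, hε, h⟩
    refine ⟨_, Metric.ball_mem_nhds _ hε, fun S hS => h S ?_⟩
    rwa [Set.mem_preimage, Metric.mem_ball, dist_eq_norm, ← map_sub] at hS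

theorem mem_relInterior_iff {X S : Set (E →ₗ[ℂ] E)} {T : E →ₗ[ℂ] E} :
    T ∈ relInterior X S ↔ T ∈ X ∧ ∃ ε > 0, ∀ R ∈ X, opNorm (R - T) < ε → R ∈ S := by
  have key : ∀ h : T ∈ X, (⟨T, h⟩ : X) ∈ interior ((↑) ⁻¹' S : Set X) ↔
      ∃ ε > 0, ∀ R ∈ X, opNorm (R - T) < ε → R ∈ S := by
    intro h
    rw [mem_interior_iff_mem_nhds, nhds_subtype_eq_comap, mem_comap]
    constructor
    · rintro ⟨V, hV, hVS⟩
      obtain ⟨ε, hε, h⟩ := mem_nhds_iff_opNorm.mp hV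
      exact ⟨ε, hε, fun R hR hRT => hVS (a := ⟨R, hR⟩) (h R hRT)⟩
    · rintro ⟨ε, hε, h⟩
      exact ⟨{R | opNorm (R - T) < ε}, mem_nhds_iff_opNorm.mpr ⟨ε, hε, fun _ => id⟩,
        fun R hR => h R R.2 hR⟩
  constructor
  · rintro ⟨⟨T, h⟩, hT, rfl⟩
    exact ⟨h, (key h).mp hT⟩
  · rintro ⟨h, hT⟩
    exact ⟨⟨T, h⟩, (key h).mpr hT, rfl⟩

theorem continuous_linearFunctional (f : (E →ₗ[ℂ] E) →ₗ[ℂ] ℂ) : Continuous f := by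
  have h : Continuous (f ∘ₗ LinearMap.toContinuousLinearMap.symm.toLinearMap) :=
    LinearMap.continuous_of_finiteDimensional _
  have h2 := h.comp isInducing_toContinuousLinearMap.continuous
  refine h2.congr fun T => ?_
  simp

theorem relInterior_subset {V : Type*} [TopologicalSpace V] {X S : Set V} :
    relInterior X S ⊆ S := by
  rintro _ ⟨T, hT, rfl⟩
  exact interior_subset (s := ((↑) ⁻¹' S : Set X)) hT

theorem relBoundary_eq_sdiff_relInterior {V : Type*} [TopologicalSpace V] {X S : Set V}
    (hSX : S ⊆ X) (hS : IsClosed ((↑) ⁻¹' S : Set X)) :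
    relBoundary X S = S \ relInterior X S := by
  rw [relBoundary, relInterior, hS.frontier_eq, Set.image_sdiff Subtype.val_injective,
    Subtype.image_preimage_coe, Set.inter_eq_right.mpr hSX]

end TraceNorm

/-! ### Density matrices of maximal rank -/

section Density

variable {E : Type*} [NormedAddCommGroup E] [InnerProductSpace ℂ E]

theorem trace_real_smul (c : ℝ) (T : E →ₗ[ℂ] E) :
    LinearMap.trace ℂ E (c • T) = c * LinearMap.trace ℂ E T := by
  have : c • T = (c : ℂ) • T := by ext v; simp
  rw [this, map_smul, smul_eq_mul]

theorem isSymmetric_real_smul {T : E →ₗ[ℂ] E} (hT : T.IsSymmetric) (c : ℝ) :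
    (c • T).IsSymmetric := by
  have : c • T = (c : ℂ) • T := by ext v; simp
  rw [this]
  exact hT.smul (Complex.conj_ofReal c)

theorem densityMatrices_subset : densityMatrices E ⊆ unitTraceSelfAdjoint E := fun _ h => h.1

theorem lineMap_mem_unitTraceSelfAdjoint {ρ σ : E →ₗ[ℂ] E} (hρ : ρ ∈ unitTraceSelfAdjoint E)
    (hσ : σ ∈ unitTraceSelfAdjoint E) (t : ℝ) :
    AffineMap.lineMap ρ σ t ∈ unitTraceSelfAdjoint E := by
  rw [AffineMap.lineMap_apply_module']
  refine ⟨(isSymmetric_real_smul (hσ.1.sub hρ.1) t).add hρ.1, ?_⟩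
  rw [map_add, trace_real_smul, map_sub, hρ.2, hσ.2]
  simp

theorem apply_lineMap (f : (E →ₗ[ℂ] E) →ₗ[ℂ] ℂ) (ρ σ : E →ₗ[ℂ] E) (t : ℝ) :
    f (AffineMap.lineMap ρ σ t) = t * (f σ - f ρ) + f ρ := by
  have h : t • (σ - ρ) = (t : ℂ) • (σ - ρ) := by ext v; simp
  rw [AffineMap.lineMap_apply_module', h, map_add, map_smul, map_sub, smul_eq_mul]

theorem isPositive_iff_of_isSymmetric {T : E →ₗ[ℂ] E} (hT : T.IsSymmetric) :
    T.IsPositive ↔ ∀ v, 0 ≤ (inner ℂ v (T v)).re := by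
  constructor
  · exact fun h v => h.re_inner_nonneg_right v
  · intro h
    refine ⟨hT, fun v => ?_⟩
    rw [hT v v]
    exact h v

/-- The matrix entry `T ↦ ⟨v, T w⟩` as a linear functional of the operator `T`. -/
noncomputable def matrixEntry (v w : E) : (E →ₗ[ℂ] E) →ₗ[ℂ] ℂ where
  toFun T := inner ℂ v (T w)
  map_add' S T := by simp
  map_smul' c T := by simp

theorem matrixEntry_apply (v w : E) (T : E →ₗ[ℂ] E) : matrixEntry v w T = inner ℂ v (T w) := rfl

theorem conj_matrixEntry {T : E →ₗ[ℂ] E} (hT : T.IsSymmetric) (v w : E) :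
    starRingEnd ℂ (matrixEntry v w T) = matrixEntry w v T := by
  rw [matrixEntry_apply, matrixEntry_apply, inner_conj_symm, hT]

theorem inner_sum_conj_smul {ι : Type*} [Fintype ι] (v : ι → E) (c : ι → ℂ) (T : E →ₗ[ℂ] E) :
    inner ℂ (∑ i, starRingEnd ℂ (c i) • v i) (T (∑ i, starRingEnd ℂ (c i) • v i))
      = ∑ i, ∑ j, c j * starRingEnd ℂ (c i) * matrixEntry (v j) (v i) T := by
  rw [map_sum, inner_sum]
  refine Finset.sum_congr rfl fun i _ => ?_
  rw [sum_inner]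
  refine Finset.sum_congr rfl fun j _ => ?_
  rw [map_smul, inner_smul_left, inner_smul_right, Complex.conj_conj, matrixEntry_apply]
  ring

variable [FiniteDimensional ℂ E]

theorem norm_matrixEntry_le {v w : E} (hv : ‖v‖ = 1) (hw : ‖w‖ = 1) (T : E →ₗ[ℂ] E) :
    ‖matrixEntry v w T‖ ≤ opNorm T := by
  calc ‖inner ℂ v (T w)‖ ≤ ‖v‖ * ‖T w‖ := norm_inner_le_norm _ _
    _ ≤ opNorm T := by
      rw [hv, one_mul]
      simpa [hw] using norm_apply_le_opNorm T w

/-- The orthogonal projection onto the line of a unit vector is a density matrix. -/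
theorem rankOne_mem_densityMatrices {v : E} (hv : ‖v‖ = 1) :
    ((InnerProductSpace.rankOne ℂ v v : E →L[ℂ] E) : E →ₗ[ℂ] E) ∈ densityMatrices E := by
  have hpos : ((InnerProductSpace.rankOne ℂ v v : E →L[ℂ] E) : E →ₗ[ℂ] E).IsPositive :=
    (InnerProductSpace.isPositive_rankOne_self v).toLinearMap
  refine ⟨⟨hpos.isSymmetric, ?_⟩, hpos⟩
  rw [InnerProductSpace.trace_rankOne, inner_self_eq_norm_sq_to_K, hv]
  simp

theorem hasMaximalRank_iff_injective {ρ : E →ₗ[ℂ] E} :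
    HasMaximalRank ρ ↔ Function.Injective ρ := by
  rw [LinearMap.injective_iff_surjective, ← LinearMap.range_eq_top, HasMaximalRank]
  exact ⟨Submodule.eq_top_of_finrank_eq, fun h => by rw [h, finrank_top]⟩

/-- A positive operator of maximal rank is bounded below by a positive multiple of the identity. -/
theorem exists_pos_mul_sq_norm_le {ρ : E →ₗ[ℂ] E} (hρ : ρ.IsPositive) (hr : HasMaximalRank ρ) :
    ∃ c > 0, ∀ v, c * ‖v‖ ^ 2 ≤ (inner ℂ v (ρ v)).re := by
  have hinj := hasMaximalRank_iff_injective.mp hr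
  set S := hρ.isSymmetric
  set b := S.eigenvectorBasis rfl with hb
  have hpos : ∀ i, 0 < S.eigenvalues rfl i := by
    intro i
    refine lt_of_le_of_ne (hρ.nonneg_eigenvalues rfl i) fun h => ?_
    have h1 := S.apply_eigenvectorBasis rfl i
    rw [← h] at h1
    have h2 : b i = 0 := hinj (by rw [map_zero, hb, h1, RCLike.ofReal_zero, zero_smul])
    have := b.norm_eq_one i
    rw [h2, norm_zero] at this
    exact zero_ne_one this
  obtain ⟨c, hc, hcl⟩ : ∃ c > 0, ∀ i, c ≤ S.eigenvalues rfl i := by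
    rcases isEmpty_or_nonempty (Fin (Module.finrank ℂ E)) with h | h
    · exact ⟨1, one_pos, fun i => h.elim i⟩
    · obtain ⟨i, hi⟩ := Finite.exists_min (S.eigenvalues rfl)
      exact ⟨_, hpos i, hi⟩
  refine ⟨c, hc, fun v => ?_⟩
  have h1 : (inner ℂ v (ρ v)).re = ∑ i, S.eigenvalues rfl i * ‖inner ℂ (b i) v‖ ^ 2 := by
    rw [← b.sum_inner_mul_inner v (ρ v), Complex.re_sum]
    refine Finset.sum_congr rfl fun i _ => ?_
    have h2 : ρ (b i) = ((S.eigenvalues rfl i : ℝ) : ℂ) • b i := S.apply_eigenvectorBasis rfl i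
    rw [← S (b i) v, h2, inner_smul_left, Complex.conj_ofReal, ← inner_conj_symm v (b i),
      mul_left_comm, ← Complex.normSq_eq_conj_mul_self, Complex.normSq_eq_norm_sq,
      ← Complex.ofReal_mul, Complex.ofReal_re]
  rw [h1, ← b.sum_sq_norm_inner_right v, Finset.mul_sum]
  exact Finset.sum_le_sum fun i _ => by gcongr; exact hcl i

theorem exists_apply_eq_zero_of_not_hasMaximalRank {ρ : E →ₗ[ℂ] E} (h : ¬HasMaximalRank ρ) :
    ∃ v, ‖v‖ = 1 ∧ ρ v = 0 := by
  rw [hasMaximalRank_iff_injective, injective_iff_map_eq_zero] at h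
  push Not at h
  obtain ⟨v, hv, hv0⟩ := h
  refine ⟨((‖v‖⁻¹ : ℝ) : ℂ) • v, ?_, by rw [map_smul, hv, smul_zero]⟩
  rw [norm_smul, Complex.norm_real, norm_inv, norm_norm, inv_mul_cancel₀ (norm_ne_zero_iff.mpr hv0)]

theorem relInterior_densityMatrices :
    relInterior (unitTraceSelfAdjoint E) (densityMatrices E)
      = {ρ | ρ ∈ densityMatrices E ∧ HasMaximalRank ρ} := by
  ext ρ
  constructor
  · intro hρ
    have hD := relInterior_subset hρ
    obtain ⟨hA, ε, hε, h⟩ := mem_relInterior_iff.mp hρ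
    refine ⟨hD, by_contra fun hr => ?_⟩
    -- If `ρ v = 0`, then moving away from the pure state `|v⟩⟨v|` makes `⟨v, ρ v⟩` negative.
    obtain ⟨v, hv, hρv⟩ := exists_apply_eq_zero_of_not_hasMaximalRank hr
    set P := ((InnerProductSpace.rankOne ℂ v v : E →L[ℂ] E) : E →ₗ[ℂ] E) with hP
    have hPA : P ∈ unitTraceSelfAdjoint E := (rankOne_mem_densityMatrices hv).1
    set t : ℝ := ε / (2 * (opNorm (P - ρ) + 1)) with ht
    have hn := opNorm_nonneg (P - ρ)
    have ht0 : 0 < t := by positivity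
    have hσ := h (AffineMap.lineMap ρ P (-t)) (lineMap_mem_unitTraceSelfAdjoint hA hPA _) (by
      rw [AffineMap.lineMap_apply_module', add_sub_cancel_right, opNorm_smul, abs_neg,
        abs_of_pos ht0, ht, div_mul_eq_mul_div, div_lt_iff₀ (by positivity)]
      nlinarith)
    have h1 := (isPositive_iff_of_isSymmetric hσ.1.1).mp hσ.2 v
    have h2 : inner ℂ v (AffineMap.lineMap ρ P (-t) v) = ((-t : ℝ) : ℂ) := by
      rw [AffineMap.lineMap_apply_module', LinearMap.add_apply, LinearMap.smul_apply,
        LinearMap.sub_apply, hρv, hP]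
      simp [inner_smul_right_eq_smul, inner_self_eq_norm_sq_to_K, hv]
    rw [h2, Complex.ofReal_re] at h1
    linarith
  · rintro ⟨hD, hr⟩
    obtain ⟨c, hc, hcv⟩ := exists_pos_mul_sq_norm_le hD.2 hr
    refine mem_relInterior_iff.mpr ⟨hD.1, c, hc, fun σ hσ hσρ => ⟨hσ, ?_⟩⟩
    rw [isPositive_iff_of_isSymmetric hσ.1]
    intro v
    have h1 : (inner ℂ v (σ v)).re = (inner ℂ v (ρ v)).re + (inner ℂ v ((σ - ρ) v)).re := by
      rw [LinearMap.sub_apply, inner_sub_right, Complex.sub_re]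
      ring
    have h2 : |(inner ℂ v ((σ - ρ) v)).re| ≤ c * ‖v‖ ^ 2 := by
      calc |(inner ℂ v ((σ - ρ) v)).re| ≤ ‖inner ℂ v ((σ - ρ) v)‖ := Complex.abs_re_le_norm _
        _ ≤ ‖v‖ * ‖(σ - ρ) v‖ := norm_inner_le_norm _ _
        _ ≤ ‖v‖ * (c * ‖v‖) := by
            gcongr
            exact (norm_apply_le_opNorm _ _).trans (by gcongr)
        _ = c * ‖v‖ ^ 2 := by ring
    have h3 := neg_le_of_abs_le h2
    have h4 := hcv v
    linarith

theorem isClosed_densityMatrices :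
    IsClosed ((↑) ⁻¹' densityMatrices E : Set (unitTraceSelfAdjoint E)) := by
  have : ((↑) ⁻¹' densityMatrices E : Set (unitTraceSelfAdjoint E))
      = ⋂ v : E, {ρ | 0 ≤ (matrixEntry v v ρ.1).re} := by
    ext ρ
    simp only [Set.mem_preimage, Set.mem_iInter, Set.mem_ofPred_eq]
    exact ⟨fun h => (isPositive_iff_of_isSymmetric ρ.2.1).mp h.2,
      fun h => ⟨ρ.2, (isPositive_iff_of_isSymmetric ρ.2.1).mpr h⟩⟩
  rw [this]
  exact isClosed_iInter fun v => isClosed_le continuous_const (Complex.continuous_re.comp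
    ((continuous_linearFunctional (matrixEntry v v)).comp continuous_subtype_val))

/-- The affine hull of the density matrices consists of all self-adjoint operators of trace one:
the maximally mixed state is an interior point, so that every line through it meets the density
matrices in a nontrivial segment. -/
theorem affineSpan_densityMatrices :
    (affineSpan ℝ (densityMatrices E) : Set (E →ₗ[ℂ] E)) = unitTraceSelfAdjoint E := by
  apply Set.Subset.antisymm
  · intro σ hσ
    refine affineSpan_induction (p := fun σ => σ ∈ unitTraceSelfAdjoint E) hσ
      (fun ρ hρ => hρ.1) ?_
    intro c u v w hu hv hw
    refine ⟨(isSymmetric_real_smul (hu.1.sub hv.1) c).add hw.1, ?_⟩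
    rw [vadd_eq_add, vsub_eq_sub, map_add, trace_real_smul, map_sub, hu.2, hv.2, hw.2]
    simp
  · intro σ hσ
    have hd : (Module.finrank ℂ E : ℂ) ≠ 0 := by
      intro h
      have h0 : Module.finrank ℂ E = 0 := by exact_mod_cast h
      have : Subsingleton E := Module.finrank_zero_iff.mp h0
      have h1 := hσ.2
      rw [Subsingleton.elim σ 0, map_zero] at h1
      exact zero_ne_one h1
    set d : ℝ := (Module.finrank ℂ E : ℝ) with hdd
    have hd' : 0 < d := by
      have : d ≠ 0 := by rw [hdd]; exact_mod_cast hd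
      exact lt_of_le_of_ne (Nat.cast_nonneg _) this.symm
    set ρ : E →ₗ[ℂ] E := d⁻¹ • LinearMap.id with hρ
    have hρA : ρ ∈ unitTraceSelfAdjoint E := by
      refine ⟨isSymmetric_real_smul LinearMap.IsSymmetric.id _, ?_⟩
      rw [hρ, trace_real_smul, LinearMap.trace_id]
      push_cast
      exact inv_mul_cancel₀ hd
    have hρD : ρ ∈ densityMatrices E := by
      refine ⟨hρA, (isPositive_iff_of_isSymmetric hρA.1).mpr fun v => ?_⟩
      have : inner ℂ v (ρ v) = ((d⁻¹ * ‖v‖ ^ 2 : ℝ) : ℂ) := by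
        change inner ℂ v (d⁻¹ • v) = _
        rw [inner_smul_right_eq_smul, inner_self_eq_norm_sq_to_K]
        simp
      rw [this, Complex.ofReal_re]
      positivity
    have hρr : HasMaximalRank ρ := by
      refine hasMaximalRank_iff_injective.mpr fun v w h => ?_
      exact smul_right_injective E (inv_ne_zero hd'.ne') h
    have hint : ρ ∈ relInterior (unitTraceSelfAdjoint E) (densityMatrices E) := by
      rw [relInterior_densityMatrices]
      exact ⟨hρD, hρr⟩
    obtain ⟨-, ε, hε, h⟩ := mem_relInterior_iff.mp hint
    set t : ℝ := ε / (2 * (opNorm (σ - ρ) + 1)) with ht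
    have hn := opNorm_nonneg (σ - ρ)
    have ht0 : 0 < t := by positivity
    have hτ := h (AffineMap.lineMap ρ σ t) (lineMap_mem_unitTraceSelfAdjoint hρA hσ _) (by
      rw [AffineMap.lineMap_apply_module', add_sub_cancel_right, opNorm_smul,
        abs_of_pos ht0, ht, div_mul_eq_mul_div, div_lt_iff₀ (by positivity)]
      nlinarith)
    have hσ' : σ = AffineMap.lineMap ρ (AffineMap.lineMap ρ σ t) t⁻¹ := by
      rw [AffineMap.lineMap_apply_module', AffineMap.lineMap_apply_module', add_sub_cancel_right,
        smul_smul, inv_mul_cancel₀ ht0.ne', one_smul, sub_add_cancel]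
    rw [hσ']
    exact AffineMap.lineMap_mem _ (subset_affineSpan ℝ _ hρD) (subset_affineSpan ℝ _ hτ)

theorem densityInterior_eq :
    densityInterior E = {ρ | ρ ∈ densityMatrices E ∧ HasMaximalRank ρ} := by
  rw [← relInterior_densityMatrices, ← affineSpan_densityMatrices]
  rfl

theorem densityBoundary_eq :
    densityBoundary E = {ρ | ρ ∈ densityMatrices E ∧ ¬HasMaximalRank ρ} := by
  have h : densityBoundary E = relBoundary (unitTraceSelfAdjoint E) (densityMatrices E) := by
    rw [← affineSpan_densityMatrices]
    rfl
  rw [h, relBoundary_eq_sdiff_relInterior densityMatrices_subset isClosed_densityMatrices,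
    relInterior_densityMatrices]
  ext ρ
  simp only [Set.mem_sdiff, Set.mem_ofPred_eq]
  tauto

end Density

/-! ### Polynomials times Gaussians -/

section Gaussian

theorem integrable_one_add_abs_pow_mul_exp (k : ℕ) {b : ℝ} (hb : 0 < b) :
    Integrable fun u : ℝ => (1 + |u|) ^ k * Real.exp (-b * u ^ 2) := by
  have h : ∀ j ∈ Finset.range (k + 1),
      Integrable fun u : ℝ => (k.choose j : ℝ) * (|u| ^ j * Real.exp (-b * u ^ 2)) := by
    intro j _
    have h1 := (integrable_rpow_mul_exp_neg_mul_sq hb (s := (j : ℝ))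
      (by linarith [(Nat.cast_nonneg j : (0 : ℝ) ≤ j)])).norm
    refine (h1.congr (ae_of_all _ fun u => ?_)).const_mul _
    simp [Real.rpow_natCast]
  refine (integrable_finsetSum _ h).congr (ae_of_all _ fun u => ?_)
  change _ = (1 + |u|) ^ k * _
  rw [add_comm 1 |u|, add_pow, Finset.sum_mul]
  refine Finset.sum_congr rfl fun j _ => ?_
  simp only [one_pow, mul_one]
  ring

theorem exists_norm_eval_le (p : ℂ[X]) {m : ℕ} (hm : p.natDegree ≤ m) :
    ∃ C, 0 ≤ C ∧ ∀ z, ‖p.eval z‖ ≤ C * (1 + ‖z‖) ^ m := by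
  refine ⟨∑ i ∈ Finset.range (m + 1), ‖p.coeff i‖, by positivity, fun z => ?_⟩
  rw [Polynomial.eval_eq_sum_range' (Nat.lt_succ_of_le hm), Finset.sum_mul]
  refine (norm_sum_le _ _).trans (Finset.sum_le_sum fun i hi => ?_)
  rw [norm_mul, norm_pow]
  have hz := norm_nonneg z
  gcongr
  calc ‖z‖ ^ i ≤ (1 + ‖z‖) ^ i := by gcongr; linarith
    _ ≤ (1 + ‖z‖) ^ m := pow_le_pow_right₀ (by linarith) (by
        have := Finset.mem_range.mp hi
        omega)

theorem norm_cexp_quarter (y : ℝ) :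
    ‖Complex.exp (-(1 / 4) * (y : ℂ) ^ 2)‖ = Real.exp (-(1 / 4) * y ^ 2) := by
  rw [norm_cexp_neg_mul_sq]
  norm_num

theorem norm_cexp_phase (s y : ℝ) : ‖Complex.exp (-Complex.I * s * y)‖ = 1 := by
  rw [Complex.norm_exp]
  simp

theorem integrable_phase_mul_eval_mul_cexp (s : ℝ) (a : ℂ) (R : ℂ[X]) :
    Integrable fun y : ℝ => Complex.exp (-Complex.I * s * y) *
      (R.eval (y + a) * Complex.exp (-(1 / 4) * (y : ℂ) ^ 2)) := by
  set k := (R.comp (Polynomial.X + Polynomial.C a)).natDegree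
  obtain ⟨C, hC, h⟩ := exists_norm_eval_le (R.comp (Polynomial.X + Polynomial.C a)) (m := k) le_rfl
  refine ((integrable_one_add_abs_pow_mul_exp k (by norm_num : (0 : ℝ) < 1 / 4)).const_mul C).mono'
    (by fun_prop) (ae_of_all _ fun y => ?_)
  rw [norm_mul, norm_cexp_phase, one_mul, norm_mul, norm_cexp_quarter, ← mul_assoc]
  have := h y
  simp only [Polynomial.eval_comp, Polynomial.eval_add, Polynomial.eval_X, Polynomial.eval_C,
    Complex.norm_real, Real.norm_eq_abs] at this
  gcongr

/-- Integration by parts against the Gaussian. -/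
theorem integral_phase_mul_eval_X_mul (s : ℝ) (a : ℂ) (R : ℂ[X]) :
    ∫ y : ℝ, Complex.exp (-Complex.I * s * y) *
      ((Polynomial.X * R).eval (y + a) * Complex.exp (-(1 / 4) * (y : ℂ) ^ 2)) =
    2 * (∫ y : ℝ, Complex.exp (-Complex.I * s * y) *
      ((Polynomial.derivative R).eval (y + a) * Complex.exp (-(1 / 4) * (y : ℂ) ^ 2))) +
    (a - 2 * Complex.I * s) * ∫ y : ℝ, Complex.exp (-Complex.I * s * y) *
      (R.eval (y + a) * Complex.exp (-(1 / 4) * (y : ℂ) ^ 2)) := by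
  set F : ℂ[X] → ℝ → ℂ := fun R y => Complex.exp (-Complex.I * s * y) *
      (R.eval (y + a) * Complex.exp (-(1 / 4) * (y : ℂ) ^ 2)) with hF
  have hint : ∀ R, Integrable (F R) := integrable_phase_mul_eval_mul_cexp s a
  have hder : ∀ y : ℝ, HasDerivAt (F R) (F (Polynomial.derivative R) y
      + (-Complex.I * s + a / 2) * F R y - 1 / 2 * F (Polynomial.X * R) y) y := by
    intro y
    have h1 : HasDerivAt (fun y : ℂ => Complex.exp (-Complex.I * s * y))
        (Complex.exp (-Complex.I * s * y) * (-Complex.I * s)) y := by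
      simpa using ((hasDerivAt_id (y : ℂ)).const_mul (-Complex.I * s)).cexp
    have h2 : HasDerivAt (fun y : ℂ => R.eval (y + a))
        ((Polynomial.derivative R).eval ((y : ℂ) + a)) y := by
      exact (R.hasDerivAt ((y : ℂ) + a)).comp_add_const (y : ℂ) a
    have h3 : HasDerivAt (fun y : ℂ => Complex.exp (-(1 / 4) * y ^ 2))
        (Complex.exp (-(1 / 4) * (y : ℂ) ^ 2) * (-(1 / 4) * (2 * y))) y := by
      refine (((hasDerivAt_pow 2 (y : ℂ)).const_mul (-(1 / 4))).cexp).congr_deriv ?_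
      simp
    have h4 := (h1.mul (h2.mul h3)).comp_ofReal
    refine h4.congr_deriv ?_
    simp only [hF, Polynomial.eval_mul, Polynomial.eval_X, Pi.mul_apply]
    ring
  have h0 := integral_eq_zero_of_hasDerivAt_of_integrable hder
    (((hint _).add ((hint R).const_mul _)).sub ((hint _).const_mul _)) (hint R)
  have h1 : Integrable fun y => F (Polynomial.derivative R) y
      + (-Complex.I * s + a / 2) * F R y := (hint _).add ((hint R).const_mul _)
  rw [integral_sub h1 ((hint _).const_mul _),
    integral_add (hint _) ((hint R).const_mul _), integral_const_mul, integral_const_mul] at h0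
  linear_combination -2 * h0

/-- The shift of contour `y = u - 2iξ` in the Fourier integral of a polynomial times a Gaussian. -/
theorem integral_phase_mul_eval_mul_cexp (s : ℝ) (R : ℂ[X]) :
    ∫ y : ℝ, Complex.exp (-Complex.I * s * y) *
      (R.eval (y : ℂ) * Complex.exp (-(1 / 4) * (y : ℂ) ^ 2)) =
    Complex.exp (-(s : ℂ) ^ 2) * ∫ u : ℝ, R.eval (u - 2 * Complex.I * s)
      * Complex.exp (-(1 / 4) * (u : ℂ) ^ 2) := by
  -- Both sides obey the recursion that integration by parts gives, so that it suffices to compare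
  -- them on the constant polynomial.
  set M : ℂ[X] → ℂ := fun R => ∫ y : ℝ, Complex.exp (-Complex.I * s * y) *
      (R.eval (y + 0 : ℂ) * Complex.exp (-(1 / 4) * (y : ℂ) ^ 2)) with hM
  set L : ℂ[X] → ℂ := fun R => ∫ u : ℝ, Complex.exp (-Complex.I * (0 : ℝ) * u) *
      (R.eval (u + (-2 * Complex.I * s)) * Complex.exp (-(1 / 4) * (u : ℂ) ^ 2)) with hL
  suffices h : M R = Complex.exp (-(s : ℂ) ^ 2) * L R by
    simpa [hM, hL, sub_eq_add_neg] using h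
  have hMrec : ∀ R, M (Polynomial.X * R) = 2 * M (Polynomial.derivative R)
      + (-2 * Complex.I * s) * M R := by
    intro R
    have := integral_phase_mul_eval_X_mul s 0 R
    simp only [hM]
    rw [this]
    ring
  have hLrec : ∀ R, L (Polynomial.X * R) = 2 * L (Polynomial.derivative R)
      + (-2 * Complex.I * s) * L R := by
    intro R
    have := integral_phase_mul_eval_X_mul 0 (-2 * Complex.I * s) R
    simp only [hL]
    rw [this]
    simp
  have hMadd : ∀ p q, M (p + q) = M p + M q := by
    intro p q
    simp only [hM]
    rw [← integral_add (integrable_phase_mul_eval_mul_cexp s 0 p)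
      (integrable_phase_mul_eval_mul_cexp s 0 q)]
    simp only [Polynomial.eval_add, add_mul, mul_add]
  have hLadd : ∀ p q, L (p + q) = L p + L q := by
    intro p q
    simp only [hL]
    rw [← integral_add (integrable_phase_mul_eval_mul_cexp 0 _ p)
      (integrable_phase_mul_eval_mul_cexp 0 _ q)]
    simp only [Polynomial.eval_add, add_mul, mul_add]
  have hMsmul : ∀ (c : ℂ) p, M (Polynomial.C c * p) = c * M p := by
    intro c p
    simp only [hM]
    rw [← integral_const_mul]
    congr 1 with y
    simp only [Polynomial.eval_mul, Polynomial.eval_C]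
    ring
  have hLsmul : ∀ (c : ℂ) p, L (Polynomial.C c * p) = c * L p := by
    intro c p
    simp only [hL]
    rw [← integral_const_mul]
    congr 1 with y
    simp only [Polynomial.eval_mul, Polynomial.eval_C]
    ring
  have hone : M 1 = Complex.exp (-(s : ℂ) ^ 2) * L 1 := by
    have hq : (0 : ℝ) < (1 / 4 : ℂ).re := by norm_num
    have h1 := fourierIntegral_gaussian hq (-s)
    have h2 := fourierIntegral_gaussian hq 0
    have e1 : M 1 = ∫ x : ℝ, Complex.exp (Complex.I * (-s) * x)
        * Complex.exp (-(1 / 4) * (x : ℂ) ^ 2) := by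
      simp [hM]
    have e2 : L 1 = ∫ x : ℝ, Complex.exp (Complex.I * 0 * x)
        * Complex.exp (-(1 / 4) * (x : ℂ) ^ 2) := by
      simp [hL]
    rw [e1, e2, h1, h2]
    have e3 : -(-(s : ℂ)) ^ 2 / (4 * (1 / 4)) = -(s : ℂ) ^ 2 := by ring
    rw [e3]
    simp [mul_comm]
  have hpow : ∀ n : ℕ,
      M (Polynomial.X ^ n) = Complex.exp (-(s : ℂ) ^ 2) * L (Polynomial.X ^ n) := by
    intro n
    induction n using Nat.strong_induction_on with
    | _ n ih =>
      match n with
      | 0 => simpa using hone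
      | 1 =>
        have h1 := hMrec 1
        have h2 := hLrec 1
        have h3 : M 0 = 0 := by simp [hM]
        have h4 : L 0 = 0 := by simp [hL]
        simp only [Polynomial.derivative_one, mul_one] at h1 h2
        rw [pow_one, h1, h2, h3, h4, hone]
        ring
      | n + 2 =>
        have hd : Polynomial.derivative (Polynomial.X ^ (n + 1) : ℂ[X])
            = Polynomial.C ((n + 1 : ℕ) : ℂ) * Polynomial.X ^ n := by
          simp
        rw [pow_succ', hMrec, hLrec, hd, hMsmul, hLsmul, ih n (by omega), ih (n + 1) (by omega)]
        ring
  induction R using Polynomial.induction_on' with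
  | add p q hp hq => rw [hMadd, hLadd, hp, hq, mul_add]
  | monomial n c =>
    rw [← Polynomial.C_mul_X_pow_eq_monomial, hMsmul, hLsmul, hpow]
    ring

end Gaussian

/-! ### Cross-Wigner functions of polynomials times the Gaussian -/

section CrossWigner

/-- The function `p(x) exp(-x²/2)`. -/
noncomputable def polyGauss (p : ℂ[X]) (x : ℝ) : ℂ :=
  p.eval (x : ℂ) * Complex.exp (-(1 / 2) * (x : ℂ) ^ 2)

/-- The (unnormalized) cross-Wigner function
`∫ exp(-iξy) f(x + y/2) conj (g(x - y/2)) dy` of `f = p exp(-x²/2)` and `g = q exp(-x²/2)`. -/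
noncomputable def crossWigner (p q : ℂ[X]) (z : ℝ × ℝ) : ℂ :=
  ∫ y : ℝ, Complex.exp (-Complex.I * z.2 * y)
    * (polyGauss p (z.1 + y / 2) * conj (polyGauss q (z.1 - y / 2)))

/-- The phase-space point `(x, ξ)` as the complex number `x - iξ`. -/
noncomputable def phasePoint (z : ℝ × ℝ) : ℂ := z.1 - Complex.I * z.2

/-- The polynomial factor of the cross-Wigner function, divided by its order of growth
`(1 + |ζ|)^(2m)`, as a function of `ζ = x - iξ`; cf. `crossWigner_eq`. -/
noncomputable def wignerSymbol (m : ℕ) (p q : ℂ[X]) (ζ : ℂ) : ℂ :=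
  ∫ u : ℝ, p.eval (ζ + u / 2) * conj (q.eval (ζ - u / 2)) / ((1 + ‖ζ‖ : ℝ) : ℂ) ^ (2 * m)
    * Complex.exp (-(1 / 4) * (u : ℂ) ^ 2)

theorem conj_eval (q : ℂ[X]) (z : ℂ) : conj (q.eval z) = (q.map (starRingEnd ℂ)).eval (conj z) := by
  rw [Polynomial.eval_map, Polynomial.eval₂_at_apply]

theorem conj_cexp_half (x : ℝ) :
    conj (Complex.exp (-(1 / 2) * (x : ℂ) ^ 2)) = Complex.exp (-(1 / 2) * (x : ℂ) ^ 2) := by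
  rw [← Complex.exp_conj]
  simp [map_ofNat]

/-- The polynomial in `y` given by `p(x + y/2) conj (q(x - y/2))` for real `y`. -/
noncomputable def kernelPoly (p q : ℂ[X]) (x : ℂ) : ℂ[X] :=
  p.comp (Polynomial.C x + Polynomial.C (1 / 2) * Polynomial.X)
    * (q.map (starRingEnd ℂ)).comp (Polynomial.C x - Polynomial.C (1 / 2) * Polynomial.X)

theorem eval_kernelPoly (p q : ℂ[X]) (x y : ℂ) :
    (kernelPoly p q x).eval y = p.eval (x + y / 2) * conj (q.eval (conj (x - y / 2))) := by
  rw [conj_eval, Complex.conj_conj]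
  simp only [kernelPoly, Polynomial.eval_mul, Polynomial.eval_comp, Polynomial.eval_add,
    Polynomial.eval_sub, Polynomial.eval_C, Polynomial.eval_X]
  ring_nf

theorem polyGauss_mul_conj_polyGauss (p q : ℂ[X]) (x y : ℝ) :
    polyGauss p (x + y / 2) * conj (polyGauss q (x - y / 2))
      = Complex.exp (-(x : ℂ) ^ 2) * ((kernelPoly p q x).eval (y : ℂ)
        * Complex.exp (-(1 / 4) * (y : ℂ) ^ 2)) := by
  rw [polyGauss, polyGauss, map_mul, conj_cexp_half, eval_kernelPoly]
  have h1 : conj ((x : ℂ) - y / 2) = ((x - y / 2 : ℝ) : ℂ) := by simp [map_ofNat]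
  have h2 : Complex.exp (-(1 / 2) * ((x + y / 2 : ℝ) : ℂ) ^ 2)
      * Complex.exp (-(1 / 2) * ((x - y / 2 : ℝ) : ℂ) ^ 2)
      = Complex.exp (-(x : ℂ) ^ 2) * Complex.exp (-(1 / 4) * (y : ℂ) ^ 2) := by
    rw [← Complex.exp_add, ← Complex.exp_add]
    congr 1
    push_cast
    ring
  rw [h1]
  push_cast at h2 ⊢
  linear_combination (p.eval ((x : ℂ) + y / 2) * conj (q.eval ((x : ℂ) - y / 2))) * h2

theorem crossWigner_eq (m : ℕ) (p q : ℂ[X]) (z : ℝ × ℝ) :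
    crossWigner p q z = ((Real.exp (-(z.1 ^ 2 + z.2 ^ 2)) * (1 + ‖phasePoint z‖) ^ (2 * m) : ℝ) : ℂ)
      * wignerSymbol m p q (phasePoint z) := by
  obtain ⟨x, ξ⟩ := z
  have hc : ((1 + ‖phasePoint (x, ξ)‖ : ℝ) : ℂ) ^ (2 * m) ≠ 0 := by
    refine pow_ne_zero _ ?_
    exact_mod_cast (by positivity : (1 + ‖phasePoint (x, ξ)‖ : ℝ) ≠ 0)
  have h1 : crossWigner p q (x, ξ) = Complex.exp (-(x : ℂ) ^ 2) *
      ∫ y : ℝ, Complex.exp (-Complex.I * ξ * y) * ((kernelPoly p q x).eval (y : ℂ)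
        * Complex.exp (-(1 / 4) * (y : ℂ) ^ 2)) := by
    rw [crossWigner, ← integral_const_mul]
    congr 1 with y
    rw [polyGauss_mul_conj_polyGauss]
    ring
  have h2 : ∀ u : ℝ, (kernelPoly p q x).eval ((u : ℂ) - 2 * Complex.I * ξ)
      = p.eval (phasePoint (x, ξ) + u / 2) * conj (q.eval (phasePoint (x, ξ) - u / 2)) := by
    intro u
    rw [eval_kernelPoly]
    have e1 : (x : ℂ) + (u - 2 * Complex.I * ξ) / 2 = phasePoint (x, ξ) + u / 2 := by
      simp only [phasePoint]
      ring
    have e2 : conj ((x : ℂ) - (u - 2 * Complex.I * ξ) / 2) = phasePoint (x, ξ) - u / 2 := by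
      simp only [phasePoint, map_sub, map_div₀, map_mul, Complex.conj_ofReal, Complex.conj_I,
        map_ofNat]
      ring
    rw [e1, e2]
  rw [h1, integral_phase_mul_eval_mul_cexp, wignerSymbol]
  simp only [h2]
  have h3 : ∀ u : ℝ, p.eval (phasePoint (x, ξ) + u / 2) * conj (q.eval (phasePoint (x, ξ) - u / 2))
      / ((1 + ‖phasePoint (x, ξ)‖ : ℝ) : ℂ) ^ (2 * m) * Complex.exp (-(1 / 4) * (u : ℂ) ^ 2)
      = (((1 + ‖phasePoint (x, ξ)‖ : ℝ) : ℂ) ^ (2 * m))⁻¹ * (p.eval (phasePoint (x, ξ) + u / 2)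
        * conj (q.eval (phasePoint (x, ξ) - u / 2)) * Complex.exp (-(1 / 4) * (u : ℂ) ^ 2)) := by
    intro u
    ring
  simp only [h3]
  rw [integral_const_mul, ← mul_assoc, ← Complex.exp_add, ← mul_assoc]
  congr 1
  rw [Complex.ofReal_mul, Complex.ofReal_pow, mul_assoc, mul_inv_cancel₀ hc, mul_one,
    Complex.ofReal_exp]
  congr 1
  push_cast
  ring

theorem conj_wignerSymbol (m : ℕ) (p q : ℂ[X]) (ζ : ℂ) :
    conj (wignerSymbol m p q ζ) = wignerSymbol m q p ζ := by
  rw [wignerSymbol, ← integral_conj, ← integral_neg_eq_self, wignerSymbol]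
  congr 1 with u
  have : conj (Complex.exp (-(1 / 4) * (u : ℂ) ^ 2)) = Complex.exp (-(1 / 4) * (u : ℂ) ^ 2) := by
    rw [← Complex.exp_conj]
    simp [map_ofNat]
  simp only [map_mul, map_div₀, map_pow, Complex.conj_conj, Complex.conj_ofReal,
    Complex.ofReal_neg, neg_sq, this, neg_div, sub_neg_eq_add, ← sub_eq_add_neg]
  ring

/-- The integrands of the symbols are bounded by a fixed Gaussian, uniformly in `ζ`. -/
theorem exists_norm_wignerSymbol_integrand_le {m : ℕ} {p q : ℂ[X]} (hp : p.natDegree ≤ m)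
    (hq : q.natDegree ≤ m) :
    ∃ C, ∀ (ζ : ℂ) (u : ℝ), ‖p.eval (ζ + u / 2) * conj (q.eval (ζ - u / 2))
      / ((1 + ‖ζ‖ : ℝ) : ℂ) ^ (2 * m) * Complex.exp (-(1 / 4) * (u : ℂ) ^ 2)‖
      ≤ C * ((1 + |u|) ^ (2 * m) * Real.exp (-(1 / 4) * u ^ 2)) := by
  obtain ⟨C, hC, hCp⟩ := exists_norm_eval_le p hp
  obtain ⟨D, hD, hDq⟩ := exists_norm_eval_le q hq
  refine ⟨C * D, fun ζ u => ?_⟩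
  have hζ := norm_nonneg ζ
  have hu := abs_nonneg u
  have hhalf : ‖(u : ℂ) / 2‖ = |u| / 2 := by simp
  have h1 : 1 + ‖ζ + u / 2‖ ≤ (1 + ‖ζ‖) * (1 + |u|) := by
    have := norm_add_le ζ (u / 2)
    rw [hhalf] at this
    nlinarith
  have h2 : 1 + ‖ζ - u / 2‖ ≤ (1 + ‖ζ‖) * (1 + |u|) := by
    have := norm_sub_le ζ (u / 2)
    rw [hhalf] at this
    nlinarith
  have h3 : ‖((1 + ‖ζ‖ : ℝ) : ℂ)‖ = 1 + ‖ζ‖ := by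
    rw [Complex.norm_real, Real.norm_eq_abs, abs_of_nonneg (by positivity)]
  rw [norm_mul, norm_cexp_quarter, norm_div, norm_mul, RCLike.norm_conj, norm_pow, h3, ← mul_assoc]
  gcongr
  rw [div_le_iff₀ (by positivity)]
  calc ‖p.eval (ζ + u / 2)‖ * ‖q.eval (ζ - u / 2)‖
      ≤ (C * ((1 + ‖ζ‖) * (1 + |u|)) ^ m) * (D * ((1 + ‖ζ‖) * (1 + |u|)) ^ m) := by
        gcongr
        · exact (hCp _).trans (by gcongr)
        · exact (hDq _).trans (by gcongr)
    _ = C * D * (1 + |u|) ^ (2 * m) * (1 + ‖ζ‖) ^ (2 * m) := by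
        rw [mul_pow]
        ring

theorem continuous_wignerSymbol {m : ℕ} {p q : ℂ[X]} (hp : p.natDegree ≤ m)
    (hq : q.natDegree ≤ m) : Continuous (wignerSymbol m p q) := by
  obtain ⟨C, h⟩ := exists_norm_wignerSymbol_integrand_le hp hq
  refine continuous_of_dominated (fun ζ => ?_) (fun ζ => ae_of_all _ (h ζ))
    ((integrable_one_add_abs_pow_mul_exp _ (by norm_num)).const_mul C) (ae_of_all _ fun u => ?_)
  · exact (Continuous.aestronglyMeasurable (by fun_prop))
  · refine Continuous.mul (Continuous.div (by fun_prop) (by fun_prop) fun ζ => pow_ne_zero _ ?_)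
      continuous_const
    exact_mod_cast (by positivity : (1 + ‖ζ‖ : ℝ) ≠ 0)

theorem tendsto_eval_div_pow {m : ℕ} {p : ℂ[X]} (hp : p.natDegree ≤ m) :
    Tendsto (fun ζ : ℂ => p.eval ζ / ζ ^ m) (Bornology.cobounded ℂ) (𝓝 (p.coeff m)) := by
  have h0 : ∀ᶠ ζ : ℂ in Bornology.cobounded ℂ, ζ ≠ 0 := Bornology.eventually_ne_cobounded 0
  have h1 : Tendsto (fun ζ : ℂ => (p.reflect m).eval ζ⁻¹) (Bornology.cobounded ℂ)
      (𝓝 ((p.reflect m).eval 0)) :=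
    ((p.reflect m).continuous.tendsto 0).comp tendsto_inv₀_cobounded
  have h2 : (p.reflect m).eval 0 = p.coeff m := by
    rw [← Polynomial.coeff_zero_eq_eval_zero, Polynomial.coeff_reflect, Polynomial.revAt_zero]
  rw [h2] at h1
  refine h1.congr' (h0.mono fun ζ hζ => ?_)
  let := invertibleOfNonzero hζ
  have := Polynomial.eval₂_reflect_mul_pow (RingHom.id ℂ) ζ m p hp
  rw [Polynomial.eval₂_id, Polynomial.eval₂_id, invOf_eq_inv] at this
  change _ = p.eval ζ / ζ ^ m
  rw [← this, mul_div_cancel_right₀ _ (pow_ne_zero m hζ)]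

/-- The cross-Wigner functions have the leading term of a product of monomials. -/
theorem tendsto_wignerSymbol {m : ℕ} {p q : ℂ[X]} (hp : p.natDegree ≤ m) (hq : q.natDegree ≤ m) :
    Tendsto (wignerSymbol m p q) (Bornology.cobounded ℂ)
      (𝓝 (p.coeff m * conj (q.coeff m) * (√(Real.pi / (1 / 4)) : ℝ))) := by
  obtain ⟨C, h⟩ := exists_norm_wignerSymbol_integrand_le hp hq
  have hG : ∫ u : ℝ, p.coeff m * conj (q.coeff m) * Complex.exp (-(1 / 4) * (u : ℂ) ^ 2)
      = p.coeff m * conj (q.coeff m) * (√(Real.pi / (1 / 4)) : ℝ) := by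
    rw [integral_const_mul, ← integral_gaussian, ← integral_complex_ofReal]
    congr 2 with u
    push_cast
    rfl
  rw [← hG]
  have h0 : ∀ᶠ ζ : ℂ in Bornology.cobounded ℂ, ζ ≠ 0 := Bornology.eventually_ne_cobounded 0
  have : (Bornology.cobounded ℂ).IsCountablyGenerated := by
    rw [← comap_norm_atTop]
    infer_instance
  refine tendsto_integral_filter_of_dominated_convergence _
    (Eventually.of_forall fun ζ => ?_) (Eventually.of_forall fun ζ => ae_of_all _ (h ζ))
    ((integrable_one_add_abs_pow_mul_exp _ (by norm_num)).const_mul C) (ae_of_all _ fun u => ?_)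
  · exact (Continuous.aestronglyMeasurable (by fun_prop))
  · refine Tendsto.mul_const _ ?_
    have hshift : ∀ (a : ℂ) {r : ℂ[X]}, r.natDegree ≤ m →
        Tendsto (fun ζ : ℂ => r.eval (ζ + a) / ζ ^ m) (Bornology.cobounded ℂ) (𝓝 (r.coeff m)) := by
      intro a r hr
      have e1 : Tendsto (fun ζ : ℂ => ζ + a) (Bornology.cobounded ℂ) (Bornology.cobounded ℂ) :=
        tendsto_add_const_cobounded a
      have e2 := (tendsto_eval_div_pow hr).comp e1
      have e3 : Tendsto (fun ζ : ℂ => (1 + a * ζ⁻¹) ^ m) (Bornology.cobounded ℂ) (𝓝 1) := by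
        have := ((tendsto_inv₀_cobounded (α := ℂ)).const_mul a).const_add 1
        simpa using this.pow m
      have e4 := e2.mul e3
      rw [mul_one] at e4
      have e5 : ∀ᶠ ζ : ℂ in Bornology.cobounded ℂ, ζ + a ≠ 0 :=
        e1.eventually (Bornology.eventually_ne_cobounded 0)
      refine e4.congr' ?_
      filter_upwards [h0, e5] with ζ h1 h2
      have : 1 + a * ζ⁻¹ = (ζ + a) / ζ := by field_simp
      rw [Function.comp_apply, this, div_pow]
      field_simp
    have hw : Tendsto (fun ζ : ℂ => (((‖ζ‖ / (1 + ‖ζ‖)) ^ (2 * m) : ℝ) : ℂ))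
        (Bornology.cobounded ℂ) (𝓝 1) := by
      have e1 : Tendsto (fun ζ : ℂ => (‖ζ‖⁻¹ + 1)⁻¹ ^ (2 * m)) (Bornology.cobounded ℂ) (𝓝 1) := by
        have := ((tendsto_norm_cobounded_atTop (E := ℂ)).inv_tendsto_atTop.add_const 1).inv₀
          (by norm_num)
        simpa using this.pow (2 * m)
      have e2 := (Complex.continuous_ofReal.tendsto 1).comp e1
      rw [Complex.ofReal_one] at e2
      refine e2.congr' (h0.mono fun ζ hζ => ?_)
      have : ‖ζ‖ ≠ 0 := norm_ne_zero_iff.mpr hζ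
      rw [Function.comp_apply]
      congr 2
      field_simp
    have hprod := ((hshift (u / 2) hp).mul
      ((Complex.continuous_conj.tendsto _).comp (hshift (-(u / 2)) hq))).mul hw
    rw [mul_one] at hprod
    refine hprod.congr' (h0.mono fun ζ hζ => ?_)
    have hn : ((‖ζ‖ : ℝ) : ℂ) ^ (2 * m) = ζ ^ m * conj (ζ ^ m) := by
      rw [Complex.mul_conj, Complex.normSq_eq_norm_sq, norm_pow]
      push_cast
      ring
    have hζ' : conj (ζ ^ m) ≠ 0 := by simpa using fun h => (hζ h).elim
    have hζm := pow_ne_zero m hζ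
    rw [Function.comp_apply, map_div₀, Complex.ofReal_pow, Complex.ofReal_div, div_pow, hn,
      ← sub_eq_add_neg]
    field_simp

end CrossWigner

/-! ### The Wigner function in an orthonormal basis -/

section Basis

theorem exists_polyGauss_of_mem_fockSpan {N : ℕ} {ψ : L2R} (hψ : ψ ∈ fockSpan N) :
    ∃ p : ℂ[X], ψ =ᵐ[volume] polyGauss p := by
  induction hψ using Submodule.span_induction with
  | mem ψ h =>
    obtain ⟨n, -, rfl⟩ := h
    refine ⟨Polynomial.C (((2 ^ n * (n.factorial : ℝ)) ^ (-(1 / 2) : ℝ)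
      * Real.pi ^ (-(1 / 4) : ℝ) : ℝ) : ℂ) * (hermitePoly n).map (algebraMap ℝ ℂ), ?_⟩
    filter_upwards [(memLp_hermiteFun n).coeFn_toLp] with x hx
    rw [fock, hx, hermiteFun, polyGauss, Polynomial.eval_mul, Polynomial.eval_C,
      Polynomial.eval_map, ← Complex.coe_algebraMap, Polynomial.eval₂_at_apply]
    simp
  | zero =>
    refine ⟨0, (Lp.coeFn_zero ℂ 2 volume).trans (ae_of_all _ fun x => ?_)⟩
    simp [polyGauss]
  | add ψ φ _ _ hψ hφ =>
    obtain ⟨p, hp⟩ := hψ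
    obtain ⟨q, hq⟩ := hφ
    refine ⟨p + q, ?_⟩
    filter_upwards [Lp.coeFn_add ψ φ, hp, hq] with x h1 h2 h3
    rw [h1, Pi.add_apply, h2, h3, polyGauss, polyGauss, polyGauss, Polynomial.eval_add, add_mul]
  | smul c ψ _ hψ =>
    obtain ⟨p, hp⟩ := hψ
    refine ⟨Polynomial.C c * p, ?_⟩
    filter_upwards [Lp.coeFn_smul c ψ, hp] with x h1 h2
    rw [h1, Pi.smul_apply, h2, polyGauss, polyGauss, Polynomial.eval_mul, Polynomial.eval_C,
      smul_eq_mul, mul_assoc]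

theorem ae_comp_add_mul {P : ℝ → Prop} (h : ∀ᵐ t, P t) (x : ℝ) {c : ℝ} (hc : c ≠ 0) :
    ∀ᵐ y, P (x + c * y) := by
  have h1 : ∀ᵐ t, P (x + t) := (measurePreserving_add_left volume x).quasiMeasurePreserving.ae h
  rw [ae_iff] at h1 ⊢
  have h2 : {y : ℝ | ¬P (x + c * y)} = (c • ·) ⁻¹' {t : ℝ | ¬P (x + t)} := rfl
  rw [h2, Measure.addHaar_preimage_smul _ hc, h1, mul_zero]

theorem integrable_phase_mul_polyGauss (s : ℝ) (p q : ℂ[X]) (x : ℝ) :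
    Integrable fun y : ℝ => Complex.exp (-Complex.I * s * y)
      * (polyGauss p (x + y / 2) * conj (polyGauss q (x - y / 2))) := by
  refine ((integrable_phase_mul_eval_mul_cexp s 0 (kernelPoly p q x)).const_mul
    (Complex.exp (-(x : ℂ) ^ 2))).congr (ae_of_all _ fun y => ?_)
  simp only [polyGauss_mul_conj_polyGauss, add_zero]
  ring

variable {H : Submodule ℂ L2R} [FiniteDimensional ℂ H]

/-- The integral kernel of `ρ`, with polynomials times the Gaussian as representatives of the basis
vectors. -/
noncomputable def polyKernel (p : Fin (Module.finrank ℂ H) → ℂ[X]) (ρ : H →ₗ[ℂ] H) (s t : ℝ) : ℂ :=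
  ∑ i, ∑ j, matrixEntry (stdOrthonormalBasis ℂ H j) (stdOrthonormalBasis ℂ H i) ρ
    * (polyGauss (p j) s * conj (polyGauss (p i) t))

variable {p : Fin (Module.finrank ℂ H) → ℂ[X]}

theorem wigner_eq_integral_polyKernel
    (hp : ∀ i, (stdOrthonormalBasis ℂ H i : L2R) =ᵐ[volume] polyGauss (p i))
    (ρ : H →ₗ[ℂ] H) (z : ℝ × ℝ) :
    wigner ρ z = 1 / (2 * Real.pi) *
      ∫ y : ℝ, Complex.exp (-Complex.I * z.2 * y) * polyKernel p ρ (z.1 + y / 2) (z.1 - y / 2) := by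
  set b := stdOrthonormalBasis ℂ H with hb
  have h1 : ∀ᵐ t : ℝ, ∀ i, (b i : L2R) t = polyGauss (p i) t := ae_all_iff.mpr hp
  have h2 : ∀ᵐ t : ℝ, ∀ i, (ρ (b i) : L2R) t
      = ∑ j, matrixEntry (b j) (b i) ρ * polyGauss (p j) t := by
    rw [ae_all_iff]
    intro i
    have e1 : (ρ (b i) : L2R) = ∑ j, matrixEntry (b j) (b i) ρ • (b j : L2R) := by
      conv_lhs => rw [← b.sum_repr' (ρ (b i))]
      simp [matrixEntry]
    have e2 : ∀ᵐ t : ℝ, ∀ j, (matrixEntry (b j) (b i) ρ • (b j : L2R) : L2R) t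
        = matrixEntry (b j) (b i) ρ * (b j : L2R) t := by
      rw [ae_all_iff]
      intro j
      filter_upwards [Lp.coeFn_smul (matrixEntry (b j) (b i) ρ) (b j : L2R)] with t ht
      rw [ht]
      rfl
    rw [e1]
    filter_upwards [e2, h1, Lp.coeFn_fun_finsetSum Finset.univ
      fun j => matrixEntry (b j) (b i) ρ • (b j : L2R)] with t g1 g2 g3
    rw [g3]
    exact Finset.sum_congr rfl fun j _ => by rw [g1, g2]
  -- For fixed `(x, ξ)` the points `x ± y/2` avoid a given null set for almost every `y`, so that
  -- `wigner` does not depend on the representatives of the basis vectors.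
  rw [wigner]
  congr 1
  refine integral_congr_ae ?_
  filter_upwards [ae_comp_add_mul h2 z.1 (by norm_num : (1 / 2 : ℝ) ≠ 0),
    ae_comp_add_mul h1 z.1 (by norm_num : (-1 / 2 : ℝ) ≠ 0)] with y g1 g2
  have e1 : z.1 + 1 / 2 * y = z.1 + y / 2 := by ring
  have e2 : z.1 + -1 / 2 * y = z.1 - y / 2 := by ring
  rw [e1] at g1
  rw [e2] at g2
  simp only [kernel, polyKernel]
  congr 1
  refine Finset.sum_congr rfl fun i _ => ?_
  rw [← hb, g1, g2, Finset.sum_mul]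
  exact Finset.sum_congr rfl fun j _ => by ring

/-- The polynomial factor of the Wigner function, divided by its order of growth
`(1 + |ζ|)^(2m)`, as a linear functional of the operator; cf. `wigner_eq`. -/
noncomputable def operatorSymbol (m : ℕ) (p : Fin (Module.finrank ℂ H) → ℂ[X]) (ζ : ℂ) :
    (H →ₗ[ℂ] H) →ₗ[ℂ] ℂ :=
  ∑ i, ∑ j, wignerSymbol m (p j) (p i) ζ •
    matrixEntry (stdOrthonormalBasis ℂ H j) (stdOrthonormalBasis ℂ H i)

theorem operatorSymbol_apply (m : ℕ) (p : Fin (Module.finrank ℂ H) → ℂ[X]) (ζ : ℂ)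
    (ρ : H →ₗ[ℂ] H) : operatorSymbol m p ζ ρ = ∑ i, ∑ j, wignerSymbol m (p j) (p i) ζ *
      matrixEntry (stdOrthonormalBasis ℂ H j) (stdOrthonormalBasis ℂ H i) ρ := by
  simp [operatorSymbol, LinearMap.sum_apply]

/-- The positive factor relating the Wigner function to its symbol. -/
noncomputable def wignerWeight (m : ℕ) (z : ℝ × ℝ) : ℝ :=
  1 / (2 * Real.pi) * (Real.exp (-(z.1 ^ 2 + z.2 ^ 2)) * (1 + ‖phasePoint z‖) ^ (2 * m))

theorem wignerWeight_pos (m : ℕ) (z : ℝ × ℝ) : 0 < wignerWeight m z := by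
  unfold wignerWeight
  positivity

theorem wigner_eq (hp : ∀ i, (stdOrthonormalBasis ℂ H i : L2R) =ᵐ[volume] polyGauss (p i))
    (m : ℕ) (ρ : H →ₗ[ℂ] H) (z : ℝ × ℝ) :
    wigner ρ z = wignerWeight m z * operatorSymbol m p (phasePoint z) ρ := by
  rw [wigner_eq_integral_polyKernel hp]
  simp only [polyKernel, Finset.mul_sum]
  have hint : ∀ i j, Integrable fun y : ℝ => Complex.exp (-Complex.I * z.2 * y) *
      (matrixEntry (stdOrthonormalBasis ℂ H j) (stdOrthonormalBasis ℂ H i) ρ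
        * (polyGauss (p j) (z.1 + y / 2) * conj (polyGauss (p i) (z.1 - y / 2)))) := by
    intro i j
    refine ((integrable_phase_mul_polyGauss z.2 (p j) (p i) z.1).const_mul
      (matrixEntry (stdOrthonormalBasis ℂ H j) (stdOrthonormalBasis ℂ H i) ρ)).congr
      (ae_of_all _ fun y => ?_)
    ring
  rw [integral_finsetSum _ fun i _ => integrable_finsetSum _ fun j _ => hint i j,
    operatorSymbol_apply, Finset.mul_sum, Finset.mul_sum]
  refine Finset.sum_congr rfl fun i _ => ?_
  rw [integral_finsetSum _ fun j _ => hint i j, Finset.mul_sum, Finset.mul_sum]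
  refine Finset.sum_congr rfl fun j _ => ?_
  have e := crossWigner_eq m (p j) (p i) z
  rw [crossWigner] at e
  rw [integral_congr_ae (ae_of_all _ fun y => mul_left_comm _ (matrixEntry _ _ ρ) _),
    integral_const_mul, e, wignerWeight]
  push_cast
  ring

theorem im_operatorSymbol {ρ : H →ₗ[ℂ] H} (hρ : ρ.IsSymmetric) (m : ℕ) (ζ : ℂ) :
    (operatorSymbol m p ζ ρ).im = 0 := by
  rw [← Complex.conj_eq_iff_im, operatorSymbol_apply]
  simp only [map_sum]
  rw [Finset.sum_comm]
  refine Finset.sum_congr rfl fun i _ => Finset.sum_congr rfl fun j _ => ?_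
  rw [map_mul, conj_wignerSymbol]
  rw [conj_matrixEntry hρ]

open scoped ComplexOrder in
theorem wigner_nonneg_iff (hp : ∀ i, (stdOrthonormalBasis ℂ H i : L2R) =ᵐ[volume] polyGauss (p i))
    {ρ : H →ₗ[ℂ] H} (hρ : ρ.IsSymmetric) (m : ℕ) (z : ℝ × ℝ) :
    0 ≤ wigner ρ z ↔ 0 ≤ (operatorSymbol m p (phasePoint z) ρ).re := by
  have h : operatorSymbol m p (phasePoint z) ρ
      = ((operatorSymbol m p (phasePoint z) ρ).re : ℂ) :=
    Complex.ext rfl (by rw [im_operatorSymbol hρ, Complex.ofReal_im])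
  rw [wigner_eq hp m, h, ← Complex.ofReal_mul, Complex.zero_le_real,
    mul_nonneg_iff_of_pos_left (wignerWeight_pos m z), Complex.ofReal_re]

theorem wigner_eq_zero_iff
    (hp : ∀ i, (stdOrthonormalBasis ℂ H i : L2R) =ᵐ[volume] polyGauss (p i))
    (ρ : H →ₗ[ℂ] H) (m : ℕ) (z : ℝ × ℝ) :
    wigner ρ z = 0 ↔ operatorSymbol m p (phasePoint z) ρ = 0 := by
  rw [wigner_eq hp m, mul_eq_zero, or_iff_right]
  exact_mod_cast (wignerWeight_pos m z).ne'

theorem continuous_operatorSymbol {m : ℕ} (hm : ∀ i, (p i).natDegree ≤ m) (ρ : H →ₗ[ℂ] H) :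
    Continuous fun ζ => operatorSymbol m p ζ ρ := by
  simp only [operatorSymbol_apply]
  exact continuous_finsetSum _ fun i _ => continuous_finsetSum _ fun j _ =>
    (continuous_wignerSymbol (hm j) (hm i)).mul continuous_const

theorem exists_norm_operatorSymbol_le {m : ℕ} (hm : ∀ i, (p i).natDegree ≤ m) :
    ∃ C > 0, ∀ (ρ : H →ₗ[ℂ] H) (ζ : ℂ), ‖operatorSymbol m p ζ ρ‖ ≤ C * opNorm ρ := by
  have h : ∀ i j, ∃ C, 0 ≤ C ∧ ∀ ζ, ‖wignerSymbol m (p j) (p i) ζ‖ ≤ C := by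
    intro i j
    obtain ⟨C, hC⟩ := exists_norm_wignerSymbol_integrand_le (hm j) (hm i)
    have hb : ∀ ζ, ‖wignerSymbol m (p j) (p i) ζ‖
        ≤ ∫ u : ℝ, C * ((1 + |u|) ^ (2 * m) * Real.exp (-(1 / 4) * u ^ 2)) := fun ζ =>
      norm_integral_le_of_norm_le
        ((integrable_one_add_abs_pow_mul_exp _ (by norm_num)).const_mul C) (ae_of_all _ (hC ζ))
    exact ⟨_, (norm_nonneg _).trans (hb 0), hb⟩
  choose C hC0 hC using h
  refine ⟨∑ i, ∑ j, C i j + 1, ?_, fun ρ ζ => ?_⟩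
  · have := Finset.sum_nonneg fun i (_ : i ∈ Finset.univ) =>
      Finset.sum_nonneg fun j (_ : j ∈ Finset.univ) => hC0 i j
    linarith
  have h0 := opNorm_nonneg ρ
  rw [operatorSymbol_apply, add_mul, Finset.sum_mul]
  refine le_add_of_le_of_nonneg ((norm_sum_le _ _).trans (Finset.sum_le_sum fun i _ => ?_))
    (by positivity)
  rw [Finset.sum_mul]
  refine (norm_sum_le _ _).trans (Finset.sum_le_sum fun j _ => ?_)
  rw [norm_mul]
  exact mul_le_mul (hC i j ζ) (norm_matrixEntry_le (OrthonormalBasis.norm_eq_one _ _)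
    (OrthonormalBasis.norm_eq_one _ _) ρ) (norm_nonneg _) (hC0 i j)

/-- At infinity the symbol of `ρ` tends to a multiple of `⟨w, ρ w⟩`, where `w` represents the
functional that takes the coefficient of degree `m`. -/
theorem tendsto_operatorSymbol {m : ℕ} (hm : ∀ i, (p i).natDegree ≤ m) (ρ : H →ₗ[ℂ] H) :
    Tendsto (fun ζ => operatorSymbol m p ζ ρ) (Bornology.cobounded ℂ)
      (𝓝 ((√(Real.pi / (1 / 4)) : ℝ) * inner ℂ
        (∑ i, conj ((p i).coeff m) • stdOrthonormalBasis ℂ H i)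
        (ρ (∑ i, conj ((p i).coeff m) • stdOrthonormalBasis ℂ H i)))) := by
  have h : Tendsto (fun ζ => operatorSymbol m p ζ ρ) (Bornology.cobounded ℂ)
      (𝓝 (∑ i, ∑ j, ((p j).coeff m * conj ((p i).coeff m) * (√(Real.pi / (1 / 4)) : ℝ))
        * matrixEntry (stdOrthonormalBasis ℂ H j) (stdOrthonormalBasis ℂ H i) ρ)) := by
    simp only [operatorSymbol_apply]
    exact tendsto_finsetSum _ fun i _ => tendsto_finsetSum _ fun j _ =>
      (tendsto_wignerSymbol (hm j) (hm i)).mul_const _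
  convert h using 2
  refine (congrArg _ (inner_sum_conj_smul (fun i => stdOrthonormalBasis ℂ H i)
    (fun i => (p i).coeff m) ρ)).trans ?_
  rw [Finset.mul_sum]
  refine Finset.sum_congr rfl fun i _ => ?_
  rw [Finset.mul_sum]
  refine Finset.sum_congr rfl fun j _ => ?_
  ring

/-- If `m` is the maximal degree, then `w` does not vanish. -/
theorem exists_natDegree_le_and_sum_ne_zero [Nontrivial H]
    (hp : ∀ i, (stdOrthonormalBasis ℂ H i : L2R) =ᵐ[volume] polyGauss (p i)) :
    ∃ m, (∀ i, (p i).natDegree ≤ m) ∧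
      ∑ i, conj ((p i).coeff m) • stdOrthonormalBasis ℂ H i ≠ 0 := by
  have : Nonempty (Fin (Module.finrank ℂ H)) := ⟨⟨0, Module.finrank_pos⟩⟩
  obtain ⟨k, hk⟩ := Finite.exists_max fun i => (p i).natDegree
  refine ⟨(p k).natDegree, hk, fun h => ?_⟩
  have h1 := linearIndependent_iff'.mp (stdOrthonormalBasis ℂ H).orthonormal.linearIndependent
    Finset.univ _ h k (Finset.mem_univ k)
  have h2 : p k = 0 := by
    rw [← Polynomial.leadingCoeff_eq_zero, Polynomial.leadingCoeff]
    simpa using h1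
  have h3 : (stdOrthonormalBasis ℂ H k : L2R) = 0 := by
    refine (Lp.eq_zero_iff_ae_eq_zero).mpr ((hp k).trans (ae_of_all _ fun x => ?_))
    simp [h2, polyGauss]
  have h4 := (stdOrthonormalBasis ℂ H).norm_eq_one k
  rw [Submodule.coe_eq_zero.mp h3, norm_zero] at h4
  exact zero_ne_one h4

end Basis

/-! ### Nowhere vanishing Wigner functions of states of maximal rank -/

section Interior

theorem exists_pos_le_of_tendsto_cobounded {f : ℂ → ℝ} (hf : Continuous f) {L : ℝ} (hL : 0 < L)
    (hlim : Tendsto f (Bornology.cobounded ℂ) (𝓝 L)) (h0 : ∀ ζ, f ζ ≠ 0) :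
    ∃ δ > 0, ∀ ζ, δ ≤ f ζ := by
  have h1 : ∀ᶠ ζ in Bornology.cobounded ℂ, L / 2 < f ζ :=
    hlim.eventually (lt_mem_nhds (by linarith))
  obtain ⟨a, ha⟩ := h1.exists
  have hpos : ∀ ζ, 0 < f ζ := by
    intro ζ
    by_contra hζ
    obtain ⟨c, hc⟩ := mem_range_of_exists_le_of_exists_ge hf ⟨ζ, not_lt.mp hζ⟩
      ⟨a, by linarith⟩
    exact h0 c hc
  have h2 : Bornology.IsBounded {ζ | L / 2 < f ζ}ᶜ := by
    rw [Bornology.isBounded_def, compl_compl]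
    exact h1
  obtain ⟨R, hR⟩ := (Metric.isBounded_iff_subset_closedBall (0 : ℂ)).mp h2
  obtain ⟨c, -, hc⟩ := (isCompact_closedBall (0 : ℂ) (max R 0)).exists_isMinOn
    ⟨0, by simp⟩ hf.continuousOn
  refine ⟨min (L / 2) (f c), lt_min (by linarith) (hpos c), fun ζ => ?_⟩
  by_cases hζ : L / 2 < f ζ
  · exact (min_le_left _ _).trans hζ.le
  · refine (min_le_right _ _).trans (hc ?_)
    exact Metric.closedBall_subset_closedBall (le_max_left _ _) (hR hζ)

theorem phasePoint_surjective : Function.Surjective phasePoint := by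
  intro ζ
  refine ⟨(ζ.re, -ζ.im), ?_⟩
  apply Complex.ext <;> simp [phasePoint]

variable {H : Submodule ℂ L2R} [FiniteDimensional ℂ H]
  {p : Fin (Module.finrank ℂ H) → ℂ[X]} {m : ℕ}

/-- The Wigner function of a state of maximal rank is positive near infinity, to the largest
order of growth that the Wigner function of any operator on `H` has. -/
theorem exists_tendsto_re_operatorSymbol (hm : ∀ i, (p i).natDegree ≤ m)
    (hw : ∑ i, conj ((p i).coeff m) • stdOrthonormalBasis ℂ H i ≠ 0) {ρ : H →ₗ[ℂ] H}
    (hρ : ρ.IsPositive) (hr : HasMaximalRank ρ) :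
    ∃ L > 0, Tendsto (fun ζ => (operatorSymbol m p ζ ρ).re) (Bornology.cobounded ℂ) (𝓝 L) := by
  obtain ⟨c, hc, hcv⟩ := exists_pos_mul_sq_norm_le hρ hr
  have h := (Complex.continuous_re.tendsto _).comp (tendsto_operatorSymbol hm ρ)
  refine ⟨_, ?_, h⟩
  rw [Complex.re_ofReal_mul]
  have h1 := hcv (∑ i, conj ((p i).coeff m) • stdOrthonormalBasis ℂ H i)
  have h2 := norm_pos_iff.mpr hw
  have h3 : 0 < √(Real.pi / (1 / 4)) := Real.sqrt_pos.mpr (by positivity)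
  exact mul_pos h3 (lt_of_lt_of_le (by positivity) h1)

/-- The normalized symbol of `ρ` is bounded below by a positive constant, and that of `σ - ρ` is
small when `σ` is close to `ρ`; so the Wigner function of `σ` stays nonnegative. -/
theorem mem_relInterior_wignerPositive
    (hp : ∀ i, (stdOrthonormalBasis ℂ H i : L2R) =ᵐ[volume] polyGauss (p i))
    (hm : ∀ i, (p i).natDegree ≤ m)
    (hw : ∑ i, conj ((p i).coeff m) • stdOrthonormalBasis ℂ H i ≠ 0) {ρ : H →ₗ[ℂ] H}
    (hρ : ρ ∈ densityMatrices H) (hr : HasMaximalRank ρ) (hN : nodalSet ρ = ∅) :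
    ρ ∈ relInterior (unitTraceSelfAdjoint H) (wignerPositive H) := by
  obtain ⟨L, hL, hlim⟩ := exists_tendsto_re_operatorSymbol hm hw hρ.2 hr
  obtain ⟨δ, hδ, hδle⟩ := exists_pos_le_of_tendsto_cobounded
    (Complex.continuous_re.comp (continuous_operatorSymbol hm ρ)) hL hlim fun ζ hζ => by
      obtain ⟨z, rfl⟩ := phasePoint_surjective ζ
      have h1 : z ∈ nodalSet ρ := (wigner_eq_zero_iff hp ρ m z).mpr
        (Complex.ext hζ (im_operatorSymbol hρ.1.1 m _))
      rw [hN] at h1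
      exact h1
  have hint : ρ ∈ relInterior (unitTraceSelfAdjoint H) (densityMatrices H) := by
    rw [relInterior_densityMatrices]
    exact ⟨hρ, hr⟩
  obtain ⟨-, ε, hε, hD⟩ := mem_relInterior_iff.mp hint
  obtain ⟨C, hC, hCle⟩ := exists_norm_operatorSymbol_le hm
  refine mem_relInterior_iff.mpr ⟨hρ.1, min ε (δ / C), lt_min hε (by positivity),
    fun σ hσ hσρ => ⟨hD σ hσ (hσρ.trans_le (min_le_left _ _)), fun z => ?_⟩⟩
  rw [wigner_nonneg_iff hp hσ.1 m]
  have h1 := hδle (phasePoint z)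
  have h2 := hCle (σ - ρ) (phasePoint z)
  have h3 : C * opNorm (σ - ρ) < δ := by
    rw [mul_comm, ← lt_div_iff₀ hC]
    exact hσρ.trans_le (min_le_right _ _)
  have h4 := neg_le_of_abs_le ((Complex.abs_re_le_norm _).trans h2)
  rw [map_sub, Complex.sub_re] at h4
  change δ ≤ (operatorSymbol m p (phasePoint z) ρ).re at h1
  linarith

theorem isClosed_wignerPositive
    (hp : ∀ i, (stdOrthonormalBasis ℂ H i : L2R) =ᵐ[volume] polyGauss (p i)) :
    IsClosed ((↑) ⁻¹' wignerPositive H : Set (unitTraceSelfAdjoint H)) := by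
  have : ((↑) ⁻¹' wignerPositive H : Set (unitTraceSelfAdjoint H))
      = ((↑) ⁻¹' densityMatrices H) ∩
        ⋂ z : ℝ × ℝ, {ρ | 0 ≤ (operatorSymbol 0 p (phasePoint z) ρ.1).re} := by
    ext ρ
    simp only [Set.mem_preimage, Set.mem_inter_iff, Set.mem_iInter, Set.mem_ofPred_eq]
    exact and_congr_right fun _ => forall_congr' fun z => wigner_nonneg_iff hp ρ.2.1 0 z
  rw [this]
  exact isClosed_densityMatrices.inter (isClosed_iInter fun z => isClosed_le continuous_const
    (Complex.continuous_re.comp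
      ((continuous_linearFunctional (operatorSymbol 0 p (phasePoint z))).comp
        continuous_subtype_val)))

end Interior

/-! ### The overlap of a Wigner function with its reflection in a point -/

section Reflection

theorem integral_phase_eq_fourier (f : ℝ → ℂ) (v : ℝ) :
    ∫ y : ℝ, Complex.exp (-Complex.I * (2 * Real.pi * v : ℝ) * y) * f y = 𝓕 f v := by
  rw [Real.fourier_real_eq_integral_exp_smul]
  congr 1 with y
  rw [smul_eq_mul]
  congr 2
  push_cast
  ring

/-- Parseval's identity, in the bilinear form and with the normalization that suits Wigner
functions. -/
theorem integral_fourier_mul_fourier_neg {f g : ℝ → ℂ} (hf : Integrable f) (hg : Integrable g)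
    (hgc : Continuous g)
    (hg' : Integrable fun ξ : ℝ => ∫ y : ℝ, Complex.exp (-Complex.I * (-ξ : ℝ) * y) * g y) :
    ∫ ξ : ℝ, (∫ y : ℝ, Complex.exp (-Complex.I * ξ * y) * f y)
      * (∫ y : ℝ, Complex.exp (-Complex.I * (-ξ : ℝ) * y) * g y)
    = 2 * Real.pi * ∫ y : ℝ, f y * g y := by
  have h2 : (2 * Real.pi : ℝ) ≠ 0 := by positivity
  have hinv : ∀ v : ℝ, ∫ y : ℝ, Complex.exp (-Complex.I * (-(2 * Real.pi * v) : ℝ) * y) * g y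
      = 𝓕⁻ g v := by
    intro v
    rw [Real.fourierInv_eq_fourier_neg, ← integral_phase_eq_fourier, mul_neg]
  have hgi : Integrable (𝓕⁻ g) := by
    refine (hg'.comp_mul_left' h2).congr (ae_of_all _ fun v => ?_)
    exact hinv v
  have hgF : Integrable (𝓕 g) := by
    have h := hgi.comp_neg
    refine h.congr (ae_of_all _ fun v => ?_)
    change 𝓕⁻ g (-v) = 𝓕 g v
    rw [Real.fourierInv_eq_fourier_neg, neg_neg]
  have key : ∫ v, 𝓕 f v * 𝓕⁻ g v = ∫ y, f y * g y := by
    have h := VectorFourier.integral_fourierIntegral_smul_eq_flip (μ := volume) (ν := volume)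
      (L := innerₗ ℝ) Real.continuous_fourierChar continuous_inner hf hgi
    rw [flip_innerₗ] at h
    have h3 : 𝓕 (𝓕⁻ g) = g := hgc.fourier_fourierInv_eq hg hgF
    calc ∫ v, 𝓕 f v * 𝓕⁻ g v = ∫ y, f y * 𝓕 (𝓕⁻ g) y := h
      _ = _ := by rw [h3]
  rw [← key]
  have h4 := Measure.integral_comp_mul_left (fun ξ : ℝ =>
    (∫ y : ℝ, Complex.exp (-Complex.I * ξ * y) * f y)
      * (∫ y : ℝ, Complex.exp (-Complex.I * (-ξ : ℝ) * y) * g y)) (2 * Real.pi)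
  simp only [hinv, integral_phase_eq_fourier] at h4
  rw [h4, abs_of_pos (by positivity), Complex.real_smul]
  push_cast
  field_simp

theorem measurePreserving_add_half_sub_half :
    MeasurePreserving (fun z : ℝ × ℝ => (z.1 + z.2 / 2, z.1 - z.2 / 2)) := by
  have h1 : MeasurePreserving (fun z : ℝ × ℝ => (z.1, z.2 + z.1 / 2))
      (volume.prod volume) (volume.prod volume) :=
    (MeasurePreserving.id volume).skew_product (g := fun y x : ℝ => x + y / 2) (by fun_prop)
      (ae_of_all _ fun y => (measurePreserving_add_right volume (y / 2)).map_eq)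
  have h2 : MeasurePreserving (fun z : ℝ × ℝ => (z.1, z.1 - z.2))
      (volume.prod volume) (volume.prod volume) :=
    (MeasurePreserving.id volume).skew_product (g := fun u y : ℝ => u - y) (by fun_prop)
      (ae_of_all _ fun u => (Measure.measurePreserving_sub_left volume u).map_eq)
  have h3 := h2.comp (Measure.measurePreserving_swap.comp
    (h1.comp Measure.measurePreserving_swap))
  have h4 : (fun z : ℝ × ℝ => (z.1 + z.2 / 2, z.1 - z.2 / 2)) = (fun z : ℝ × ℝ => (z.1, z.1 - z.2))
      ∘ Prod.swap ∘ (fun z : ℝ × ℝ => (z.1, z.2 + z.1 / 2)) ∘ Prod.swap := by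
    funext z
    refine Prod.ext rfl ?_
    change z.1 - z.2 / 2 = z.1 + z.2 / 2 - z.2
    ring
  rw [h4]
  exact h3

variable {H : Submodule ℂ L2R} [FiniteDimensional ℂ H]
  {p : Fin (Module.finrank ℂ H) → ℂ[X]} {m : ℕ}

theorem continuous_polyGauss (p : ℂ[X]) : Continuous (polyGauss p) := by
  unfold polyGauss
  fun_prop

theorem continuous_wigner
    (hp : ∀ i, (stdOrthonormalBasis ℂ H i : L2R) =ᵐ[volume] polyGauss (p i))
    (hm : ∀ i, (p i).natDegree ≤ m) (ρ : H →ₗ[ℂ] H) : Continuous (wigner ρ) := by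
  have h : wigner ρ = fun z => (wignerWeight m z : ℂ) * operatorSymbol m p (phasePoint z) ρ :=
    funext fun z => wigner_eq hp m ρ z
  have h1 : Continuous phasePoint := by
    unfold phasePoint
    fun_prop
  have h2 : Continuous (wignerWeight m) := by
    unfold wignerWeight
    fun_prop
  rw [h]
  exact (Complex.continuous_ofReal.comp h2).mul ((continuous_operatorSymbol hm ρ).comp h1)

/-- Every section of a Wigner function is bounded by a Gaussian times a polynomial. -/
theorem exists_norm_wigner_le
    (hp : ∀ i, (stdOrthonormalBasis ℂ H i : L2R) =ᵐ[volume] polyGauss (p i))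
    (hm : ∀ i, (p i).natDegree ≤ m) (ρ : H →ₗ[ℂ] H) (x : ℝ) :
    ∃ C, ∀ ξ, ‖wigner ρ (x, ξ)‖ ≤ C * ((1 + |ξ|) ^ (2 * m) * Real.exp (-1 * ξ ^ 2)) := by
  obtain ⟨C, hC, hCle⟩ := exists_norm_operatorSymbol_le hm
  refine ⟨1 / (2 * Real.pi) * (1 + |x|) ^ (2 * m) * (C * opNorm ρ), fun ξ => ?_⟩
  have h0 := opNorm_nonneg ρ
  rw [wigner_eq hp m, norm_mul, Complex.norm_real, Real.norm_eq_abs,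
    abs_of_pos (wignerWeight_pos _ _)]
  have h1 : 1 + ‖phasePoint (x, ξ)‖ ≤ (1 + |x|) * (1 + |ξ|) := by
    have := norm_sub_le (x : ℂ) (Complex.I * ξ)
    rw [norm_mul, Complex.norm_I, one_mul, Complex.norm_real, Complex.norm_real,
      Real.norm_eq_abs, Real.norm_eq_abs] at this
    have h2 : ‖phasePoint (x, ξ)‖ ≤ |x| + |ξ| := this
    nlinarith [abs_nonneg x, abs_nonneg ξ]
  have h2 : Real.exp (-(x ^ 2 + ξ ^ 2)) ≤ Real.exp (-1 * ξ ^ 2) :=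
    Real.exp_le_exp.mpr (by nlinarith [sq_nonneg x])
  calc wignerWeight m (x, ξ) * ‖operatorSymbol m p (phasePoint (x, ξ)) ρ‖
      ≤ (1 / (2 * Real.pi) * (Real.exp (-1 * ξ ^ 2) * ((1 + |x|) * (1 + |ξ|)) ^ (2 * m)))
        * (C * opNorm ρ) := by
        unfold wignerWeight
        gcongr
        exact hCle _ _
    _ = _ := by
        rw [mul_pow]
        ring

theorem integrable_wigner_section
    (hp : ∀ i, (stdOrthonormalBasis ℂ H i : L2R) =ᵐ[volume] polyGauss (p i))
    (hm : ∀ i, (p i).natDegree ≤ m) (ρ : H →ₗ[ℂ] H) (x : ℝ) :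
    Integrable fun ξ => wigner ρ (x, ξ) := by
  obtain ⟨C, hC⟩ := exists_norm_wigner_le hp hm ρ x
  exact ((integrable_one_add_abs_pow_mul_exp _ one_pos).const_mul C).mono'
    ((continuous_wigner hp hm ρ).comp (by fun_prop)).aestronglyMeasurable (ae_of_all _ hC)

theorem integrable_wigner_mul_reflection_section
    (hp : ∀ i, (stdOrthonormalBasis ℂ H i : L2R) =ᵐ[volume] polyGauss (p i))
    (hm : ∀ i, (p i).natDegree ≤ m) (ρ : H →ₗ[ℂ] H) (z : ℝ × ℝ) (x : ℝ) :
    Integrable fun ξ => wigner ρ (z.1 + x, z.2 + ξ) * wigner ρ (z.1 - x, z.2 - ξ) := by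
  -- The trivial bound of the Fourier integral does not depend on `ξ`.
  have hb : ∀ ξ, ‖wigner ρ (z.1 - x, z.2 - ξ)‖ ≤ ‖(1 / (2 * Real.pi) : ℂ)‖
      * ∫ y : ℝ, ‖polyKernel p ρ (z.1 - x + y / 2) (z.1 - x - y / 2)‖ := by
    intro ξ
    rw [wigner_eq_integral_polyKernel hp, norm_mul]
    gcongr
    refine (norm_integral_le_integral_norm _).trans_eq (integral_congr_ae (ae_of_all _ fun y => ?_))
    simp only [norm_mul, norm_cexp_phase, one_mul]
  have hc : Continuous fun ξ : ℝ => (z.1 - x, z.2 - ξ) := by fun_prop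
  exact ((integrable_wigner_section hp hm ρ (z.1 + x)).comp_add_left z.2).mul_bdd
    ((continuous_wigner hp hm ρ).comp hc).aestronglyMeasurable (ae_of_all _ hb)

/-- The kernel of the overlap of `Wρ` with its reflection in the point `z`. -/
noncomputable def reflectionKernel (p : Fin (Module.finrank ℂ H) → ℂ[X]) (ρ : H →ₗ[ℂ] H)
    (z : ℝ × ℝ) (u v : ℝ) : ℂ :=
  Complex.exp (-Complex.I * z.2 * (2 * (u - v) : ℝ)) *
    (polyKernel p ρ (z.1 + u) (z.1 + v) * polyKernel p ρ (z.1 - v) (z.1 - u))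

theorem continuous_polyKernel_comp (ρ : H →ₗ[ℂ] H) {f g : ℝ → ℝ} (hf : Continuous f)
    (hg : Continuous g) : Continuous fun y => polyKernel p ρ (f y) (g y) := by
  unfold polyKernel
  refine continuous_finsetSum _ fun i _ => continuous_finsetSum _ fun j _ => ?_
  exact continuous_const.mul (((continuous_polyGauss _).comp hf).mul
    (Complex.continuous_conj.comp ((continuous_polyGauss _).comp hg)))

theorem integrable_phase_mul_polyKernel (s : ℝ) (ρ : H →ₗ[ℂ] H) (x : ℝ) :
    Integrable fun y : ℝ => Complex.exp (-Complex.I * s * y)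
      * polyKernel p ρ (x + y / 2) (x - y / 2) := by
  simp only [polyKernel, Finset.mul_sum]
  refine integrable_finsetSum _ fun i _ => integrable_finsetSum _ fun j _ => ?_
  refine ((integrable_phase_mul_polyGauss s (p j) (p i) x).const_mul
    (matrixEntry (stdOrthonormalBasis ℂ H j) (stdOrthonormalBasis ℂ H i) ρ)).congr
    (ae_of_all _ fun y => ?_)
  ring

theorem integral_wigner_mul_reflection_section
    (hp : ∀ i, (stdOrthonormalBasis ℂ H i : L2R) =ᵐ[volume] polyGauss (p i))
    (hm : ∀ i, (p i).natDegree ≤ m) (ρ : H →ₗ[ℂ] H) (z : ℝ × ℝ) (x : ℝ) :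
    ∫ ξ, wigner ρ (z.1 + x, z.2 + ξ) * wigner ρ (z.1 - x, z.2 - ξ)
      = 1 / (2 * Real.pi) * ∫ y, reflectionKernel p ρ z (x + y / 2) (x - y / 2) := by
  set f : ℝ → ℂ := fun y => Complex.exp (-Complex.I * z.2 * y)
    * polyKernel p ρ (z.1 + x + y / 2) (z.1 + x - y / 2) with hf
  set g : ℝ → ℂ := fun y => Complex.exp (-Complex.I * z.2 * y)
    * polyKernel p ρ (z.1 - x + y / 2) (z.1 - x - y / 2) with hg
  have hpi : (Real.pi : ℂ) ≠ 0 := Complex.ofReal_ne_zero.mpr Real.pi_ne_zero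
  have hWf : ∀ ξ : ℝ, ∫ y : ℝ, Complex.exp (-Complex.I * ξ * y) * f y
      = 2 * Real.pi * wigner ρ (z.1 + x, z.2 + ξ) := by
    intro ξ
    rw [wigner_eq_integral_polyKernel hp, ← mul_assoc, mul_one_div_cancel (by simp [hpi]),
      one_mul]
    congr 1 with y
    rw [hf, ← mul_assoc, ← Complex.exp_add]
    congr 2
    push_cast
    ring
  have hWg : ∀ ξ : ℝ, ∫ y : ℝ, Complex.exp (-Complex.I * (-ξ : ℝ) * y) * g y
      = 2 * Real.pi * wigner ρ (z.1 - x, z.2 - ξ) := by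
    intro ξ
    rw [wigner_eq_integral_polyKernel hp, ← mul_assoc, mul_one_div_cancel (by simp [hpi]),
      one_mul]
    congr 1 with y
    rw [hg, ← mul_assoc, ← Complex.exp_add]
    congr 2
    push_cast
    ring
  have hgc : Continuous g := by
    have h1 : Continuous fun y : ℝ => Complex.exp (-Complex.I * z.2 * y) := by fun_prop
    have h2 : Continuous fun y : ℝ => z.1 - x + y / 2 := by fun_prop
    have h3 : Continuous fun y : ℝ => z.1 - x - y / 2 := by fun_prop
    exact h1.mul (continuous_polyKernel_comp ρ h2 h3)
  have hgI : Integrable fun ξ : ℝ => ∫ y : ℝ, Complex.exp (-Complex.I * (-ξ : ℝ) * y) * g y := by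
    rw [funext hWg]
    exact ((integrable_wigner_section hp hm ρ (z.1 - x)).comp_sub_left z.2).const_mul _
  have h := integral_fourier_mul_fourier_neg (f := f) (g := g)
    (integrable_phase_mul_polyKernel z.2 ρ (z.1 + x))
    (integrable_phase_mul_polyKernel z.2 ρ (z.1 - x)) hgc hgI
  have hfg : ∀ y, f y * g y = reflectionKernel p ρ z (x + y / 2) (x - y / 2) := by
    intro y
    have e1 : z.1 + (x + y / 2) = z.1 + x + y / 2 := by ring
    have e2 : z.1 + (x - y / 2) = z.1 + x - y / 2 := by ring
    have e3 : z.1 - (x - y / 2) = z.1 - x + y / 2 := by ring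
    have e4 : z.1 - (x + y / 2) = z.1 - x - y / 2 := by ring
    have e5 : Complex.exp (-Complex.I * z.2 * (2 * (x + y / 2 - (x - y / 2)) : ℝ))
        = Complex.exp (-Complex.I * z.2 * y) * Complex.exp (-Complex.I * z.2 * y) := by
      rw [← Complex.exp_add]
      congr 1
      push_cast
      ring
    rw [reflectionKernel, e1, e2, e3, e4, e5, hf, hg]
    ring
  simp only [← hfg]
  have h' : ∫ ξ : ℝ, (2 * Real.pi * wigner ρ (z.1 + x, z.2 + ξ))
      * (2 * Real.pi * wigner ρ (z.1 - x, z.2 - ξ)) = 2 * Real.pi * ∫ y, f y * g y := by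
    rw [← h]
    exact integral_congr_ae (ae_of_all _ fun ξ => by simp only [← hWf, ← hWg])
  have h'' : ∀ ξ : ℝ, (2 * Real.pi * wigner ρ (z.1 + x, z.2 + ξ))
      * (2 * Real.pi * wigner ρ (z.1 - x, z.2 - ξ)) = (2 * Real.pi) ^ 2
      * (wigner ρ (z.1 + x, z.2 + ξ) * wigner ρ (z.1 - x, z.2 - ξ)) := fun ξ => by ring
  simp only [h''] at h'
  rw [integral_const_mul] at h'
  field_simp
  field_simp at h'
  linear_combination h'

/-- The integrand of `crossWigner p q z` at `y = 2u`. -/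
noncomputable def reflectionFactor (p q : ℂ[X]) (z : ℝ × ℝ) (u : ℝ) : ℂ :=
  Complex.exp (-Complex.I * z.2 * (2 * u : ℝ))
    * (polyGauss p (z.1 + u) * conj (polyGauss q (z.1 - u)))

theorem reflectionFactor_eq (p q : ℂ[X]) (z : ℝ × ℝ) (u : ℝ) :
    reflectionFactor p q z u = Complex.exp (-Complex.I * z.2 * (2 * u : ℝ))
      * (polyGauss p (z.1 + (2 * u) / 2) * conj (polyGauss q (z.1 - (2 * u) / 2))) := by
  rw [reflectionFactor, mul_div_cancel_left₀ u two_ne_zero]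

theorem integrable_reflectionFactor (p q : ℂ[X]) (z : ℝ × ℝ) :
    Integrable (reflectionFactor p q z) := by
  rw [funext (reflectionFactor_eq p q z)]
  exact (integrable_phase_mul_polyGauss z.2 p q z.1).comp_mul_left' two_ne_zero

theorem integral_reflectionFactor (p q : ℂ[X]) (z : ℝ × ℝ) :
    ∫ u, reflectionFactor p q z u = |(2 : ℝ)⁻¹| • crossWigner p q z := by
  rw [funext (reflectionFactor_eq p q z)]
  exact Measure.integral_comp_mul_left (fun y : ℝ => Complex.exp (-Complex.I * z.2 * y)
    * (polyGauss p (z.1 + y / 2) * conj (polyGauss q (z.1 - y / 2)))) 2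

/-- In the coordinates `u = x + y/2` and `v = x - y/2` the overlap separates. -/
theorem reflectionKernel_eq (ρ : H →ₗ[ℂ] H) (z : ℝ × ℝ) (u v : ℝ) :
    reflectionKernel p ρ z u v = ∑ i, ∑ j, ∑ k, ∑ l,
      matrixEntry (stdOrthonormalBasis ℂ H j) (stdOrthonormalBasis ℂ H i) ρ
      * matrixEntry (stdOrthonormalBasis ℂ H l) (stdOrthonormalBasis ℂ H k) ρ
      * (reflectionFactor (p j) (p k) z u * reflectionFactor (p l) (p i) z (-v)) := by
  have h : Complex.exp (-Complex.I * z.2 * (2 * (u - v) : ℝ))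
      = Complex.exp (-Complex.I * z.2 * (2 * u : ℝ))
        * Complex.exp (-Complex.I * z.2 * (2 * -v : ℝ)) := by
    rw [← Complex.exp_add]
    congr 1
    push_cast
    ring
  rw [reflectionKernel, h]
  rw [polyKernel, Finset.sum_mul, Finset.mul_sum]
  refine Finset.sum_congr rfl fun i _ => ?_
  rw [Finset.sum_mul, Finset.mul_sum]
  refine Finset.sum_congr rfl fun j _ => ?_
  rw [polyKernel, Finset.mul_sum, Finset.mul_sum]
  refine Finset.sum_congr rfl fun k _ => ?_
  rw [Finset.mul_sum, Finset.mul_sum]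
  refine Finset.sum_congr rfl fun l _ => ?_
  rw [reflectionFactor, reflectionFactor, sub_neg_eq_add, ← sub_eq_add_neg]
  ring

theorem integrable_reflectionKernel (ρ : H →ₗ[ℂ] H) (z : ℝ × ℝ) :
    Integrable fun s : ℝ × ℝ => reflectionKernel p ρ z s.1 s.2 := by
  simp only [reflectionKernel_eq]
  refine integrable_finsetSum _ fun i _ => integrable_finsetSum _ fun j _ =>
    integrable_finsetSum _ fun k _ => integrable_finsetSum _ fun l _ => Integrable.const_mul ?_ _
  exact (integrable_reflectionFactor (p j) (p k) z).mul_prod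
    (integrable_reflectionFactor (p l) (p i) z).comp_neg

theorem integral_reflectionKernel {z : ℝ × ℝ} (hz : ∀ j k, crossWigner (p j) (p k) z = 0)
    (ρ : H →ₗ[ℂ] H) : ∫ s : ℝ × ℝ, reflectionKernel p ρ z s.1 s.2 = 0 := by
  simp only [reflectionKernel_eq]
  have hint : ∀ i j k l, Integrable fun s : ℝ × ℝ =>
      matrixEntry (stdOrthonormalBasis ℂ H j) (stdOrthonormalBasis ℂ H i) ρ
      * matrixEntry (stdOrthonormalBasis ℂ H l) (stdOrthonormalBasis ℂ H k) ρ
      * (reflectionFactor (p j) (p k) z s.1 * reflectionFactor (p l) (p i) z (-s.2)) :=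
    fun i j k l => ((integrable_reflectionFactor (p j) (p k) z).mul_prod
      (integrable_reflectionFactor (p l) (p i) z).comp_neg).const_mul _
  rw [integral_finsetSum _ fun i _ => integrable_finsetSum _ fun j _ =>
    integrable_finsetSum _ fun k _ => integrable_finsetSum _ fun l _ => hint i j k l]
  refine Finset.sum_eq_zero fun i _ => ?_
  rw [integral_finsetSum _ fun j _ =>
    integrable_finsetSum _ fun k _ => integrable_finsetSum _ fun l _ => hint i j k l]
  refine Finset.sum_eq_zero fun j _ => ?_
  rw [integral_finsetSum _ fun k _ => integrable_finsetSum _ fun l _ => hint i j k l]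
  refine Finset.sum_eq_zero fun k _ => ?_
  rw [integral_finsetSum _ fun l _ => hint i j k l]
  refine Finset.sum_eq_zero fun l _ => ?_
  rw [integral_const_mul]
  have h := integral_prod_mul (μ := (volume : Measure ℝ)) (ν := (volume : Measure ℝ))
    (reflectionFactor (p j) (p k) z) (fun v => reflectionFactor (p l) (p i) z (-v))
  rw [integral_reflectionFactor, hz, smul_zero, zero_mul] at h
  rw [Measure.volume_eq_prod, h, mul_zero]

/-- If all cross-Wigner functions on `H` vanish at `z`, then so does the overlap of each Wigner
function with its reflection in `z`: up to a factor it is `tr (ρ Π ρ Π)`, where `Π` is the parity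
about `z` and `⟨φ, Π ψ⟩ = 0` for all `φ` and `ψ` in `H`. -/
theorem integral_wigner_mul_reflection
    (hp : ∀ i, (stdOrthonormalBasis ℂ H i : L2R) =ᵐ[volume] polyGauss (p i))
    (hm : ∀ i, (p i).natDegree ≤ m) (ρ : H →ₗ[ℂ] H) {z : ℝ × ℝ}
    (hz : ∀ j k, crossWigner (p j) (p k) z = 0) :
    Integrable (fun x => ∫ ξ, wigner ρ (z.1 + x, z.2 + ξ) * wigner ρ (z.1 - x, z.2 - ξ)) ∧
    ∫ x, ∫ ξ, wigner ρ (z.1 + x, z.2 + ξ) * wigner ρ (z.1 - x, z.2 - ξ) = 0 := by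
  have hmp := measurePreserving_add_half_sub_half
  have hcont : Continuous fun s : ℝ × ℝ => (s.1 + s.2 / 2, s.1 - s.2 / 2) := by fun_prop
  have hI : Integrable fun s : ℝ × ℝ =>
      reflectionKernel p ρ z (s.1 + s.2 / 2) (s.1 - s.2 / 2) :=
    hmp.integrable_comp_of_integrable (integrable_reflectionKernel ρ z)
  have h0 : ∫ s : ℝ × ℝ, reflectionKernel p ρ z (s.1 + s.2 / 2) (s.1 - s.2 / 2) = 0 := by
    rw [← integral_reflectionKernel hz ρ]
    have h := integral_map (μ := volume) hcont.aemeasurable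
      (f := fun s : ℝ × ℝ => reflectionKernel p ρ z s.1 s.2) (by
        rw [hmp.map_eq]
        exact (integrable_reflectionKernel ρ z).aestronglyMeasurable)
    rw [hmp.map_eq] at h
    exact h.symm
  simp only [integral_wigner_mul_reflection_section hp hm]
  rw [Measure.volume_eq_prod] at hI h0
  refine ⟨hI.integral_prod_left.const_mul _, ?_⟩
  rw [integral_const_mul, ← integral_prod _ hI, h0, mul_zero]

end Reflection

/-! ### Interior points have empty nodal set -/

section Nodal

/-- Polarization: a linear functional that vanishes on all pure states vanishes on all operators of
rank one. -/
theorem apply_rankOne_eq_zero {E : Type*} [NormedAddCommGroup E] [InnerProductSpace ℂ E]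
    (f : (E →ₗ[ℂ] E) →ₗ[ℂ] ℂ)
    (hf : ∀ v : E, ‖v‖ = 1 → f ((InnerProductSpace.rankOne ℂ v v : E →L[ℂ] E) : E →ₗ[ℂ] E) = 0)
    (v w : E) : f ((InnerProductSpace.rankOne ℂ v w : E →L[ℂ] E) : E →ₗ[ℂ] E) = 0 := by
  set Q : E → E → ℂ := fun v w => f ((InnerProductSpace.rankOne ℂ v w : E →L[ℂ] E) : E →ₗ[ℂ] E)
    with hQ
  have hadd : ∀ a b c, Q (a + b) c = Q a c + Q b c := by
    intro a b c
    simp only [hQ]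
    rw [← map_add]
    congr 1
    ext x
    simp
  have hadd' : ∀ a b c, Q a (b + c) = Q a b + Q a c := by
    intro a b c
    simp only [hQ]
    rw [← map_add]
    congr 1
    ext x
    simp
  have hsmul : ∀ (k : ℂ) a b, Q (k • a) b = k * Q a b := by
    intro k a b
    simp only [hQ]
    rw [← smul_eq_mul, ← map_smul]
    congr 1
    ext x
    simp
  have hsmul' : ∀ (k : ℂ) a b, Q a (k • b) = conj k * Q a b := by
    intro k a b
    simp only [hQ]
    rw [← smul_eq_mul, ← map_smul]
    congr 1
    ext x
    simp
  have hdiag : ∀ a, Q a a = 0 := by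
    intro a
    by_cases ha : a = 0
    · have := hsmul 0 a a
      rw [zero_smul, zero_mul] at this
      rwa [ha] at this ⊢
    · have hn : (‖a‖ : ℂ) ≠ 0 := Complex.ofReal_ne_zero.mpr (norm_ne_zero_iff.mpr ha)
      have h1 := hf (((‖a‖⁻¹ : ℝ) : ℂ) • a) (by
        rw [norm_smul, Complex.norm_real, norm_inv, norm_norm,
          inv_mul_cancel₀ (norm_ne_zero_iff.mpr ha)])
      change Q _ _ = 0 at h1
      rw [hsmul, hsmul', Complex.conj_ofReal] at h1
      simpa [hn] using h1
  have h1 := hdiag (v + w)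
  have h2 := hdiag (v + Complex.I • w)
  rw [hadd, hadd', hadd', hdiag, hdiag] at h1
  rw [hadd, hadd', hadd', hsmul, hsmul, hsmul', hsmul', hdiag, hdiag, Complex.conj_I] at h2
  change Q v w = 0
  have h3 : -Complex.I * (Q v w - Q w v) = 0 := by linear_combination h2
  have h4 : Q v w - Q w v = 0 := by simpa using h3
  linear_combination (h1 + h4) / 2

variable {H : Submodule ℂ L2R} [FiniteDimensional ℂ H]
  {p : Fin (Module.finrank ℂ H) → ℂ[X]} {m : ℕ}

theorem operatorSymbol_rankOne (ζ : ℂ) (i j : Fin (Module.finrank ℂ H)) :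
    operatorSymbol m p ζ ((InnerProductSpace.rankOne ℂ (stdOrthonormalBasis ℂ H j)
      (stdOrthonormalBasis ℂ H i) : H →L[ℂ] H) : H →ₗ[ℂ] H) = wignerSymbol m (p j) (p i) ζ := by
  have h : ∀ i' j', matrixEntry (stdOrthonormalBasis ℂ H j') (stdOrthonormalBasis ℂ H i')
      ((InnerProductSpace.rankOne ℂ (stdOrthonormalBasis ℂ H j)
      (stdOrthonormalBasis ℂ H i) : H →L[ℂ] H) : H →ₗ[ℂ] H)
      = (if i = i' then 1 else 0) * (if j' = j then 1 else 0) := by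
    intro i' j'
    rw [matrixEntry_apply, ContinuousLinearMap.coe_coe, InnerProductSpace.rankOne_apply,
      inner_smul_right, OrthonormalBasis.inner_eq_ite, OrthonormalBasis.inner_eq_ite]
  rw [operatorSymbol_apply]
  simp only [h]
  rw [Finset.sum_eq_single i, Finset.sum_eq_single j]
  · simp
  · intro j' _ hj
    simp [hj]
  · simp
  · intro i' _ hi
    simp [hi.symm]
  · simp

/-- At a zero of the Wigner function of an interior point, the cross-Wigner functions of all vectors
of `H` vanish: the affine function `σ ↦ Wσ(z)` has an interior minimum. -/
theorem crossWigner_eq_zero_of_mem_relInterior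
    (hp : ∀ i, (stdOrthonormalBasis ℂ H i : L2R) =ᵐ[volume] polyGauss (p i)) {ρ : H →ₗ[ℂ] H}
    (hρ : ρ ∈ relInterior (unitTraceSelfAdjoint H) (wignerPositive H)) {z : ℝ × ℝ}
    (hz : z ∈ nodalSet ρ) (j k : Fin (Module.finrank ℂ H)) : crossWigner (p j) (p k) z = 0 := by
  obtain ⟨hA, ε, hε, h⟩ := mem_relInterior_iff.mp hρ
  set f := operatorSymbol 0 p (phasePoint z) with hf
  have hfρ : f ρ = 0 := (wigner_eq_zero_iff hp ρ 0 z).mp hz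
  have hfσ : ∀ σ ∈ unitTraceSelfAdjoint H, f σ = 0 := by
    intro σ hσ
    set t : ℝ := ε / (2 * (opNorm (σ - ρ) + 1)) with ht
    have hn := opNorm_nonneg (σ - ρ)
    have ht0 : 0 < t := by positivity
    have hs : ∀ s : ℝ, |s| = t → 0 ≤ s * (f σ).re := by
      intro s hs
      have h1 := lineMap_mem_unitTraceSelfAdjoint hA hσ s
      have h2 := h _ h1 (by
        rw [AffineMap.lineMap_apply_module', add_sub_cancel_right, opNorm_smul, hs, ht,
          div_mul_eq_mul_div, div_lt_iff₀ (by positivity)]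
        nlinarith)
      have h3 := (wigner_nonneg_iff hp h1.1 0 z).mp (h2.2 z)
      rw [apply_lineMap, ← hf, hfρ, add_zero, sub_zero, Complex.re_ofReal_mul] at h3
      exact h3
    have h5 := hs t (abs_of_pos ht0)
    have h6 := hs (-t) (by rw [abs_neg, abs_of_pos ht0])
    refine Complex.ext ?_ (im_operatorSymbol hσ.1 0 _)
    have h7 : t * (f σ).re = 0 := by linarith
    simpa [ht0.ne'] using h7
  have h8 := apply_rankOne_eq_zero f (fun v hv => hfσ _ (rankOne_mem_densityMatrices hv).1)
    (stdOrthonormalBasis ℂ H j) (stdOrthonormalBasis ℂ H k)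
  rw [hf, operatorSymbol_rankOne] at h8
  rw [crossWigner_eq 0, h8, mul_zero]

/-- Otherwise the overlap of the nonnegative function `Wρ` with its reflection in a zero would
vanish, although both are positive far away from the origin. -/
theorem nodalSet_eq_empty_of_mem_relInterior
    (hp : ∀ i, (stdOrthonormalBasis ℂ H i : L2R) =ᵐ[volume] polyGauss (p i))
    (hm : ∀ i, (p i).natDegree ≤ m)
    (hw : ∑ i, conj ((p i).coeff m) • stdOrthonormalBasis ℂ H i ≠ 0) {ρ : H →ₗ[ℂ] H}
    (hr : HasMaximalRank ρ)
    (hρ : ρ ∈ relInterior (unitTraceSelfAdjoint H) (wignerPositive H)) : nodalSet ρ = ∅ := by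
  by_contra hne
  obtain ⟨z, hz⟩ := Set.nonempty_iff_ne_empty.mpr hne
  have hρ' : ρ ∈ wignerPositive H := relInterior_subset hρ
  obtain ⟨hF, hF0⟩ := integral_wigner_mul_reflection hp hm ρ
    (crossWigner_eq_zero_of_mem_relInterior hp hρ hz)
  set W : ℝ × ℝ → ℝ := fun s => (wigner ρ s).re with hW
  have hW0 : ∀ s, 0 ≤ W s := fun s => (Complex.nonneg_iff.mp (hρ'.2 s)).1
  have hWw : ∀ s, wigner ρ s = (W s : ℂ) := fun s =>
    Complex.ext rfl (Complex.nonneg_iff.mp (hρ'.2 s)).2.symm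
  have hsec : ∀ x, ∫ ξ, wigner ρ (z.1 + x, z.2 + ξ) * wigner ρ (z.1 - x, z.2 - ξ)
      = ((∫ ξ, W (z.1 + x, z.2 + ξ) * W (z.1 - x, z.2 - ξ) : ℝ) : ℂ) := by
    intro x
    rw [← integral_complex_ofReal]
    simp only [hWw, Complex.ofReal_mul]
  simp only [hsec] at hF hF0
  rw [integral_complex_ofReal, Complex.ofReal_eq_zero] at hF0
  have hsec0 : ∀ x, 0 ≤ ∫ ξ, W (z.1 + x, z.2 + ξ) * W (z.1 - x, z.2 - ξ) := fun x =>
    integral_nonneg fun ξ => mul_nonneg (hW0 _) (hW0 _)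
  have hae := (integral_eq_zero_iff_of_nonneg hsec0 (by simpa using hF.re)).mp hF0
  -- Far away from the origin `W` is positive, and so is its product with its reflection.
  obtain ⟨L, hL, hlim⟩ := exists_tendsto_re_operatorSymbol hm hw hρ'.1.2 hr
  have hbdd : Bornology.IsBounded {ζ | 0 < (operatorSymbol m p ζ ρ).re}ᶜ := by
    rw [Bornology.isBounded_def, compl_compl]
    exact hlim.eventually (lt_mem_nhds hL)
  obtain ⟨R, hR⟩ := (Metric.isBounded_iff_subset_closedBall (0 : ℂ)).mp hbdd
  have hpos : ∀ x ξ : ℝ, R < |x| → 0 < W (x, ξ) := by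
    intro x ξ hx
    rw [hW]
    dsimp only
    rw [wigner_eq hp m, Complex.re_ofReal_mul]
    refine mul_pos (wignerWeight_pos m _) (by_contra fun hneg => ?_)
    have h1 := hR hneg
    rw [mem_closedBall_zero_iff] at h1
    have h2 := Complex.abs_re_le_norm (phasePoint (x, ξ))
    have h3 : (phasePoint (x, ξ)).re = x := by simp [phasePoint]
    rw [h3] at h2
    linarith
  have hex : ∃ x, |z.1| + |R| < x ∧ ∫ ξ, W (z.1 + x, z.2 + ξ) * W (z.1 - x, z.2 - ξ) = 0 := by
    by_contra hcon
    push Not at hcon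
    have h1 : volume (Set.Ioi (|z.1| + |R|)) = 0 :=
      measure_mono_null (fun x hx => hcon x hx) hae
    rw [Real.volume_Ioi] at h1
    exact ENNReal.top_ne_zero h1
  obtain ⟨x, hx, hx0⟩ := hex
  have hint : Integrable fun ξ => W (z.1 + x, z.2 + ξ) * W (z.1 - x, z.2 - ξ) := by
    have h1 := (integrable_wigner_mul_reflection_section hp hm ρ z x).re
    simpa [hWw] using h1
  obtain ⟨ξ, hξ⟩ := ((integral_eq_zero_iff_of_nonneg
    (fun ξ => mul_nonneg (hW0 _) (hW0 _)) hint).mp hx0).exists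
  have hz1 := neg_abs_le z.1
  have hz2 := le_abs_self z.1
  have hR1 := le_abs_self R
  have h1 := hpos (z.1 + x) (z.2 + ξ) (by
    have := le_abs_self (z.1 + x)
    linarith)
  have h2 := hpos (z.1 - x) (z.2 - ξ) (by
    have := neg_le_abs (z.1 - x)
    linarith)
  exact (mul_pos h1 h2).ne' hξ

theorem relInterior_wignerPositive {N : ℕ} (hH : H ≤ fockSpan N) :
    relInterior (unitTraceSelfAdjoint H) (wignerPositive H)
      = {ρ | ρ ∈ densityMatrices H ∧ HasMaximalRank ρ ∧ nodalSet ρ = ∅} := by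
  choose p hp using fun i => exists_polyGauss_of_mem_fockSpan
    (hH (stdOrthonormalBasis ℂ H i).2)
  have hnt : ∀ ρ ∈ unitTraceSelfAdjoint H, Nontrivial H := by
    intro ρ hρ
    by_contra hcon
    rw [not_nontrivial_iff_subsingleton] at hcon
    have h1 := hρ.2
    rw [Subsingleton.elim ρ 0, map_zero] at h1
    exact zero_ne_one h1
  ext ρ
  constructor
  · intro hρ
    obtain ⟨hA, ε, hε, h⟩ := mem_relInterior_iff.mp hρ
    have : Nontrivial H := hnt ρ hA
    obtain ⟨m, hm, hw⟩ := exists_natDegree_le_and_sum_ne_zero hp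
    have hD : ρ ∈ relInterior (unitTraceSelfAdjoint H) (densityMatrices H) :=
      mem_relInterior_iff.mpr ⟨hA, ε, hε, fun σ hσ hσρ => (h σ hσ hσρ).1⟩
    rw [relInterior_densityMatrices] at hD
    exact ⟨hD.1, hD.2, nodalSet_eq_empty_of_mem_relInterior hp hm hw hD.2 hρ⟩
  · rintro ⟨hD, hr, hN⟩
    have : Nontrivial H := hnt ρ hD.1
    obtain ⟨m, hm, hw⟩ := exists_natDegree_le_and_sum_ne_zero hp
    exact mem_relInterior_wignerPositive hp hm hw hD hr hN

theorem relBoundary_wignerPositive {N : ℕ} (hH : H ≤ fockSpan N) :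
    relBoundary (unitTraceSelfAdjoint H) (wignerPositive H)
      = {ρ | ρ ∈ wignerPositive H ∧ (¬HasMaximalRank ρ ∨ (nodalSet ρ).Nonempty)} := by
  choose p hp using fun i => exists_polyGauss_of_mem_fockSpan
    (hH (stdOrthonormalBasis ℂ H i).2)
  rw [relBoundary_eq_sdiff_relInterior (fun ρ hρ => hρ.1.1) (isClosed_wignerPositive hp),
    relInterior_wignerPositive hH]
  ext ρ
  simp only [Set.mem_sdiff, Set.mem_ofPred_eq, Set.nonempty_iff_ne_empty]
  refine and_congr_right fun hρ => ?_
  have := hρ.1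
  tauto

end Nodal

end WignerPositive

theorem mainTheorem4 (N : ℕ) (H : Submodule ℂ L2R) [FiniteDimensional ℂ H]
    (hH : H ≤ fockSpan N) :
    (∀ ρ ∈ densityMatrices H,
      ρ ∈ relInterior (unitTraceSelfAdjoint H) (wignerPositive H) ↔
        HasMaximalRank ρ ∧ nodalSet ρ = ∅) ∧
    relBoundary (unitTraceSelfAdjoint H) (wignerPositive H) =
      wignerPositiveZero H ∪ (wignerPositive H ∩ densityBoundary H) ∧
    (∀ ρ, ρ ∈ relBoundary (unitTraceSelfAdjoint H) (wignerPositive H) ∩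
          densityInterior H →
        ρ ∈ wignerPositiveZero H) ∧
    (∀ ρ, ρ ∈ relBoundary (unitTraceSelfAdjoint H) (wignerPositive H) ∩
          densityBoundary H ↔
        ρ ∈ wignerPositive H ∩ densityBoundary H) := by
  rw [relInterior_wignerPositive hH, relBoundary_wignerPositive hH, densityInterior_eq,
    densityBoundary_eq]
  refine ⟨fun ρ hρ => ⟨fun h => h.2, fun h => ⟨hρ, h⟩⟩, ?_, ?_, ?_⟩
  · ext ρ
    constructor
    · rintro ⟨hρ, hr | hN⟩
      · exact Or.inr ⟨hρ, hρ.1, hr⟩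
      · exact Or.inl ⟨hρ, hN⟩
    · rintro (⟨hρ, hN⟩ | ⟨hρ, -, hr⟩)
      · exact ⟨hρ, Or.inr hN⟩
      · exact ⟨hρ, Or.inl hr⟩
  · rintro ρ ⟨⟨hρ, hr | hN⟩, -, hr'⟩
    · exact absurd hr' hr
    · exact ⟨hρ, hN⟩
  · intro ρ
    exact ⟨fun h => ⟨h.1.1, h.2⟩, fun h => ⟨⟨h.1, Or.inl h.2.2⟩, h.2⟩⟩
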